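/- **Setting.** Let $E\subset\,]0,1]$ be a set of parameters with $0\in\overline E$ (for instance $E=\,]0,1]$ or $E=\{1/n: n\ge1\}$); all limits $\varepsilon\to0^+$ are taken within $E$. For $\varepsilon\in E$ let $\ell_\varepsilon>0$ and $\alpha_\varepsilon\ge0$, with $\ell_\varepsilon$ decreasing to $0$ as $\varepsilon\to0^+$. Put $\Omega_\varepsilon=\mathbb R^2\times\,]-\ell_\varepsilon,\ell_\varepsilon[$, write $x=(x_h,x_3)$, let $n=\pm e_3$ be the exterior normal on $\partial\Omega_\varepsilon=\mathbb R^2\times\{\pm\ell_\varepsilon\}$, and for a function $f$ on $\Omega_\varepsilon$ let $\overline f(x_h)=\frac1{2\ell_\varepsilon}\int_{-\ell_\varepsilon}^{\ell_\varepsilon}f(x_h,x_3)\,dx_3$ be its vertical average. Consider on $\mathbb R_+\times\Omega_\varepsilon$ the system $$\partial_t\rho_\varepsilon+\operatorname{div}(\rho_\varepsilon u_\varepsilon)=0,\qquad \partial_t(\rho_\varepsilon u_\varepsilon)+\operatorname{div}(\rho_\varepsilon u_\varepsilon\otimes u_\varepsilon)-\Delta u_\varepsilon+\tfrac1\varepsilon\nabla\pi_\varepsilon+\tfrac1\varepsilon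 e_3\times\rho_\varepsilon u_\varepsilon=0,\qquad \operatorname{div}u_\varepsilon=0,$$ with the Navier-slip conditions $u_\varepsilon\cdot n=0$ and $(\mathbb Du_\varepsilon)n\times n=-\alpha_\varepsilon u_\varepsilon\times n$ on $\partial\Omega_\varepsilon$, where $\mathbb Du$ is the symmetric part of the Jacobian matrix $Du$, and with initial datum $(\rho_\varepsilon,\rho_\varepsilon u_\varepsilon)_{|t=0}=(\rho^{in}_\varepsilon,m^{in}_\varepsilon)$. A pair $(\rho_\varepsilon,u_\varepsilon)$ is a *global in time finite energy weak solution* if, for every $T>0$: * $0\le\rho_\varepsilon\in L^\infty([0,T[\times\Omega_\varepsilon)$, and $u_\varepsilon\in L^\infty([0,T[;L^2(\Omega_\varepsilon))\cap L^2([0,T[;H^1(\Omega_\varepsilon))$ with $\operatorname{div}u_\varepsilon=0$ in $\Omega_\varepsilon$ and $u_\varepsilon\cdot n=0$ on $\partial\Omega_\varepsilon$; * for all $\beta\in C^1_b(\mathbb R)$ and $\varphi\in C_c^\infty(\mathbb R_+\times\overline{\Omega_\varepsilon})$, $$-\iint_{\mathbb R_+\times\Omega_\varepsilon}\beta(\rho_\varepsilon)(\partial_t\varphi+u_\varepsilon\cdot\nabla\varphi)\,dx\,dt=\int_{\Omega_\varepsilon}\beta(\rho_\varepsilon^{in})\varphi(0,\cdot)\,dx;$$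 * for all $\psi\in C_c^\infty(\mathbb R_+\times\overline{\Omega_\varepsilon};\mathbb R^3)$ with $\operatorname{div}\psi=0$ and $\psi\cdot n=0$ on $\partial\Omega_\varepsilon$, $$\iint_{\mathbb R_+\times\Omega_\varepsilon}\Big(-\rho_\varepsilon u_\varepsilon\cdot\partial_t\psi-\rho_\varepsilon u_\varepsilon\otimes u_\varepsilon:\nabla\psi+\tfrac1\varepsilon e_3\times\rho_\varepsilon u_\varepsilon\cdot\psi+\nabla u_\varepsilon:\nabla\psi\Big)dx\,dt+2\alpha_\varepsilon\iint_{\mathbb R_+\times\partial\Omega_\varepsilon}u_\varepsilon\cdot\psi\,dx_h\,dt=\int_{\Omega_\varepsilon}m_\varepsilon^{in}\cdot\psi(0,\cdot)\,dx;$$ * for almost every $t\in[0,T[$, $$\tfrac12\int_{\Omega_\varepsilon}\rho_\varepsilon(t)|u_\varepsilon(t)|^2dx+\int_0^t\!\!\int_{\Omega_\varepsilon}|Du_\varepsilon|^2dx\,d\tau+2\alpha_\varepsilon\int_0^t\!\!\int_{\partial\Omega_\varepsilon}|u_\varepsilon|^2dx_h\,d\tau\le\int_{\Omega_\varepsilon}\frac{|m^{in}_\varepsilon|^2}{\rho^{in}_\varepsilon}dx.$$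 **Assumptions on the data.** Let $\rho^{in}_\varepsilon(x)=\rho^{in}_0(x_h)+\varepsilon\,r^{in}_\varepsilon(x)$, where $\rho_0^{in}\in C^2(\mathbb R^2)\cap W^{2,\infty}(\mathbb R^2)$ is not constant, and suppose that there is a constant $\rho^*>0$ with $0\le\rho_0^{in}\le\rho^*$ and $0\le\rho_\varepsilon^{in}\le2\rho^*$ for all $\varepsilon\in E$. Suppose that for each $\varepsilon\in E$ there is $\delta_\varepsilon>0$ with $\frac1{\rho^{in}_\varepsilon}\mathbf 1_{\{\rho_\varepsilon^{in}\le\delta_\varepsilon\}}\in L^1(\Omega_\varepsilon)$, that $m_\varepsilon^{in}\in L^2(\Omega_\varepsilon;\mathbb R^3)$, that $m_\varepsilon^{in}=0$ where $\rho_\varepsilon^{in}=0$, and that $|m_\varepsilon^{in}|^2/\rho_\varepsilon^{in}\in L^1(\Omega_\varepsilon)$. Suppose that, uniformly in $\varepsilon\in E$: $(\overline{r^{in}_\varepsilon})$ is bounded in $L^\infty(\mathbb R^2)\cap H^{-2}(\mathbb R^2)$; $(\overline{m_\varepsilon^{in}})$ is bounded in $L^2(\mathbb R^2)$; $\frac1{2\ell_\varepsilon}\int_{\Omega_\varepsilon}|m_\varepsilon^{in}|^2/\rho_\varepsilon^{in}\,dx\le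 C$; and, for some $\delta>0$, the averages of $\frac1{\rho_\varepsilon^{in}}\mathbf 1_{\{\rho_\varepsilon^{in}\le\delta\}}$ are bounded in $L^1(\mathbb R^2)$. Finally suppose that, for every compact $K\subset\mathbb R^2$, the Lebesgue measure of $\{y\in K:|\nabla_h\rho_0^{in}(y)|\le\delta\}$ tends to $0$ as $\delta\to0^+$. **Theorem.** Assume that $\alpha_\varepsilon/\ell_\varepsilon\to+\infty$ as $\varepsilon\to0^+$, and for every $\varepsilon\in E$ let $(\rho_\varepsilon,u_\varepsilon)$ be a global in time finite energy weak solution related to the initial datum $(\rho_\varepsilon^{in},m_\varepsilon^{in})$. Then, for every $T>0$, as $\varepsilon\to0^+$: 1. $\overline{\rho_\varepsilon}\rightharpoonup\rho_0^{in}$ weakly-$*$ in $L^\infty([0,T]\times\mathbb R^2)$; 2. after modification on a null set of times, $\overline{\rho_\varepsilon}\to\rho_0^{in}$ in $C^0([0,T];L^p_w(K))$ for every compact $K\subset\mathbb R^2$ and every $1\le p<+\infty$; that is, for every $\varphi$ in the dual $L^{p'}(K)$, $1/p+1/p'=1$, the functions $t\mapsto\int_K\overline{\rho_\varepsilon}(t)\varphi\,dx_h$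 are continuous on $[0,T]$ and converge to $\int_K\rho_0^{in}\varphi\,dx_h$ uniformly on $[0,T]$; 3. $\overline{u_\varepsilon}\to0$ strongly in $L^2([0,T];L^2(\mathbb R^2))$. -/

import Mathlib

open MeasureTheory Set Filter Topology
open scoped ENNReal ContDiff

noncomputable section

/-- The horizontal plane `ℝ²`. -/
abbrev Plane : Type := EuclideanSpace ℝ (Fin 2)

/-- Points `x = (x_h, x_3)` of physical space `ℝ³ = ℝ² × ℝ`, with product Lebesgue measure. -/
abbrev Space3 : Type := Plane × ℝ

/-- Values of vector fields: `ℝ³` with its Euclidean structure. -/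
abbrev Vec3 : Type := EuclideanSpace ℝ (Fin 3)

/-- The slab `Ω = ℝ² × ]-ℓ, ℓ[`. -/
def slab (ℓ : ℝ) : Set Space3 := univ ×ˢ Ioo (-ℓ) ℓ

/-- Lebesgue measure on the slab. -/
def slabMeasure (ℓ : ℝ) : Measure Space3 := volume.restrict (slab ℓ)

/-- Lebesgue measure on the cylinder `]0,T[ × Ω`. -/
def cylMeasure (ℓ T : ℝ) : Measure (ℝ × Space3) := volume.restrict (Ioo 0 T ×ˢ slab ℓ)

/-- Lebesgue measure on `]0,T[ × ℝ²`. -/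
def planeCylMeasure (T : ℝ) : Measure (ℝ × Plane) := volume.restrict (Ioo 0 T ×ˢ univ)

/-- The coordinate directions `e₁, e₂, e₃` of `ℝ³`. -/
def dir : Fin 3 → Space3 :=
  ![(EuclideanSpace.single 0 1, 0), (EuclideanSpace.single 1 1, 0), (0, 1)]

/-- The classical partial derivative `∂_j f`. -/
def pd {F : Type*} [NormedAddCommGroup F] [NormedSpace ℝ F] (j : Fin 3) (f : Space3 → F)
    (x : Space3) : F := fderiv ℝ f x (dir j)

/-- Smooth functions with compact support on a normed space. Restricting such functions to
a closed slab, or to `[0,∞[` times a closed slab, gives the test functions that are smooth up to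
the boundary. -/
def IsTest {X F : Type*} [NormedAddCommGroup X] [NormedSpace ℝ X] [NormedAddCommGroup F]
    [NormedSpace ℝ F] (φ : X → F) : Prop := ContDiff ℝ ∞ φ ∧ HasCompactSupport φ

/-- The vertical average `f̄(x_h) = (2ℓ)⁻¹ ∫_{-ℓ}^{ℓ} f(x_h, x_3) dx_3`. -/
def vAvg {F : Type*} [NormedAddCommGroup F] [NormedSpace ℝ F] (ℓ : ℝ) (f : Space3 → F)
    (xh : Plane) : F := (2 * ℓ)⁻¹ • ∫ z in Ioo (-ℓ) ℓ, f (xh, z)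

/-- `G j = ∂_j v` in the sense of distributions on the slab, for `j = 1, 2, 3`. -/
def IsWeakGradient (ℓ : ℝ) (v : Space3 → Vec3) (G : Space3 → Fin 3 → Vec3) : Prop :=
  ∀ φ : Space3 → ℝ, IsTest φ → tsupport φ ⊆ slab ℓ → ∀ j : Fin 3,
    ∫ x in slab ℓ, pd j φ x • v x = - ∫ x in slab ℓ, φ x • G x j

/-- `γp` and `γm` are the traces of `v` on the faces `x_3 = ℓ` and `x_3 = -ℓ`, where `G` is the weak
gradient of `v`: Green's formula in the vertical direction, tested with functions that need not
vanish on the boundary. -/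
def IsTrace (ℓ : ℝ) (v : Space3 → Vec3) (G : Space3 → Fin 3 → Vec3) (γp γm : Plane → Vec3) :
    Prop :=
  ∀ φ : Space3 → ℝ, IsTest φ →
    ∫ x in slab ℓ, (pd 2 φ x • v x + φ x • G x 2)
      = ∫ y : Plane, (φ (y, ℓ) • γp y - φ (y, -ℓ) • γm y)

/-- `div v = 0` in the slab and `v · n = 0` on its boundary, in the weak sense appropriate for
square integrable fields. -/
def IsSolenoidalTangent (ℓ : ℝ) (v : Space3 → Vec3) : Prop :=
  ∀ φ : Space3 → ℝ, IsTest φ → ∫ x in slab ℓ, ∑ j : Fin 3, v x j * pd j φ x = 0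

/-- The function spaces for the velocity `u`, its spatial gradient `Du` (`Du t x j = ∂_j u`) and its
traces `γp, γm` on the two faces:
`u ∈ L^∞(0,T; L²_σ) ∩ L²(0,T; H¹)` for every `T > 0`. -/
structure IsVelocity (ℓ : ℝ) (u : ℝ → Space3 → Vec3) (Du : ℝ → Space3 → Fin 3 → Vec3)
    (γp γm : ℝ → Plane → Vec3) : Prop where
  memLp : ∀ T : ℝ, 0 < T → MemLp (fun q : ℝ × Space3 => u q.1 q.2) 2 (cylMeasure ℓ T)
  bounded : ∀ T : ℝ, 0 < T → ∃ C : ℝ, ∀ᵐ t ∂(volume.restrict (Ioo 0 T)),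
    MemLp (u t) 2 (slabMeasure ℓ) ∧ ∫ x in slab ℓ, ‖u t x‖ ^ 2 ≤ C
  solenoidal : ∀ᵐ t ∂(volume.restrict (Ioi (0 : ℝ))), IsSolenoidalTangent ℓ (u t)
  grad_memLp : ∀ T : ℝ, 0 < T → ∀ j : Fin 3,
    MemLp (fun q : ℝ × Space3 => Du q.1 q.2 j) 2 (cylMeasure ℓ T)
  grad : ∀ᵐ t ∂(volume.restrict (Ioi (0 : ℝ))), IsWeakGradient ℓ (u t) (Du t)
  trace_memLp : ∀ T : ℝ, 0 < T → MemLp (fun q : ℝ × Plane => γp q.1 q.2) 2 (planeCylMeasure T) ∧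
    MemLp (fun q : ℝ × Plane => γm q.1 q.2) 2 (planeCylMeasure T)
  trace : ∀ᵐ t ∂(volume.restrict (Ioi (0 : ℝ))), IsTrace ℓ (u t) (Du t) (γp t) (γm t)

/-- `C¹_b(ℝ)`. -/
def IsC1b (β : ℝ → ℝ) : Prop :=
  ContDiff ℝ 1 β ∧ ∃ C : ℝ, ∀ s, |β s| ≤ C ∧ |deriv β s| ≤ C

/-- The mass equation with initial datum `ρin`, in the renormalised sense. -/
def SolvesMass (ℓ : ℝ) (ρin : Space3 → ℝ) (ρ : ℝ → Space3 → ℝ) (u : ℝ → Space3 → Vec3) : Prop :=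
  ∀ β : ℝ → ℝ, IsC1b β → ∀ φ : ℝ × Space3 → ℝ, IsTest φ →
    - ∫ t in Ioi (0 : ℝ), ∫ x in slab ℓ, β (ρ t x) *
        (deriv (fun s => φ (s, x)) t + ∑ j : Fin 3, u t x j * pd j (fun y => φ (t, y)) x)
      = ∫ x in slab ℓ, β (ρin x) * φ (0, x)

/-- The momentum equation with Coriolis force `ε⁻¹ e₃ × ρ u`, Navier-slip coefficient `α` and
initial momentum `m`, tested with divergence-free fields tangent to the boundary. -/
def SolvesMomentum (ε ℓ α : ℝ) (m : Space3 → Vec3) (ρ : ℝ → Space3 → ℝ)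
    (u : ℝ → Space3 → Vec3) (Du : ℝ → Space3 → Fin 3 → Vec3) (γp γm : ℝ → Plane → Vec3) : Prop :=
  ∀ ψ : ℝ × Space3 → Vec3, IsTest ψ →
    (∀ t, 0 ≤ t → ∀ x ∈ slab ℓ, ∑ j : Fin 3, pd j (fun y => ψ (t, y)) x j = 0) →
    (∀ t, 0 ≤ t → ∀ y : Plane, ψ (t, (y, ℓ)) 2 = 0 ∧ ψ (t, (y, -ℓ)) 2 = 0) →
    (∫ t in Ioi (0 : ℝ), ∫ x in slab ℓ,
        (- ρ t x * inner ℝ (u t x) (deriv (fun s => ψ (s, x)) t)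
          - ρ t x * ∑ i : Fin 3, ∑ j : Fin 3,
              u t x i * u t x j * pd j (fun y => ψ (t, y)) x i
          + ε⁻¹ * ρ t x * (u t x 0 * ψ (t, x) 1 - u t x 1 * ψ (t, x) 0)))
      + (∫ t in Ioi (0 : ℝ), ∫ x in slab ℓ,
          ∑ j : Fin 3, inner ℝ (Du t x j) (pd j (fun y => ψ (t, y)) x))
      + 2 * α * (∫ t in Ioi (0 : ℝ), ∫ y : Plane,
          (inner ℝ (γp t y) (ψ (t, (y, ℓ))) + inner ℝ (γm t y) (ψ (t, (y, -ℓ)))))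
      = ∫ x in slab ℓ, inner ℝ (m x) (ψ (0, x))

/-- The energy inequality. -/
def EnergyInequality (ℓ α : ℝ) (ρin : Space3 → ℝ) (m : Space3 → Vec3) (ρ : ℝ → Space3 → ℝ)
    (u : ℝ → Space3 → Vec3) (Du : ℝ → Space3 → Fin 3 → Vec3) (γp γm : ℝ → Plane → Vec3) : Prop :=
  ∀ᵐ t ∂(volume.restrict (Ioi (0 : ℝ))),
    (1 / 2) * (∫ x in slab ℓ, ρ t x * ‖u t x‖ ^ 2)
      + (∫ τ in Ioo 0 t, ∫ x in slab ℓ, ∑ j : Fin 3, ‖Du τ x j‖ ^ 2)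
      + 2 * α * (∫ τ in Ioo 0 t, ∫ y : Plane, (‖γp τ y‖ ^ 2 + ‖γm τ y‖ ^ 2))
      ≤ ∫ x in slab ℓ, ‖m x‖ ^ 2 / ρin x

/-- `(ρ, u)` is a global in time finite energy weak solution on `[0,∞[ × Ω`, related to the initial
datum `(ρ, ρ u)|_{t=0} = (ρin, m)`. The gradient and the traces of `u` are unique up to null
sets. -/
def IsFiniteEnergyWeakSolution (ε ℓ α : ℝ) (ρin : Space3 → ℝ) (m : Space3 → Vec3)
    (ρ : ℝ → Space3 → ℝ) (u : ℝ → Space3 → Vec3) : Prop :=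
  (∀ T : ℝ, 0 < T → MemLp (fun q : ℝ × Space3 => ρ q.1 q.2) ⊤ (cylMeasure ℓ T) ∧
    ∀ᵐ q ∂(cylMeasure ℓ T), 0 ≤ ρ q.1 q.2) ∧
  SolvesMass ℓ ρin ρ u ∧
  ∃ (Du : ℝ → Space3 → Fin 3 → Vec3) (γp γm : ℝ → Plane → Vec3),
    IsVelocity ℓ u Du γp γm ∧
    SolvesMomentum ε ℓ α m ρ u Du γp γm ∧
    EnergyInequality ℓ α ρin m ρ u Du γp γm

/-- The initial density `ρ_ε^in(x) = ρ_0^in(x_h) + ε r_ε^in(x)`. -/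
def initialDensity (ρ0 : Plane → ℝ) (rin : ℝ → Space3 → ℝ) (ε : ℝ) (x : Space3) : ℝ :=
  ρ0 x.1 + ε * rin ε x

/-- The `H²(ℝ²)` norm of a smooth compactly supported function. -/
def normH2 (φ : Plane → ℝ) : ℝ :=
  √(∑ k ∈ Finset.range 3, ∫ y : Plane, ‖iteratedFDeriv ℝ k φ y‖ ^ 2)

/-- `∫_{Ω ∩ {ρ ≤ δ}} 1/ρ`, with the convention `1/0 = ∞`. -/
def vacuumIntegral (ℓ : ℝ) (ρ : Space3 → ℝ) (δ : ℝ) : ℝ≥0∞ :=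
  ∫⁻ x in slab ℓ, {x | ρ x ≤ δ}.indicator (fun x => (ENNReal.ofReal (ρ x))⁻¹) x

/-- The standing assumptions on the initial data `(ρ_ε^in, m_ε^in)`, for `ε` in the parameter
set `E`. -/
structure InitialDataAssumptions (E : Set ℝ) (ℓ : ℝ → ℝ) (ρ0 : Plane → ℝ) (rin : ℝ → Space3 → ℝ)
    (m : ℝ → Space3 → Vec3) : Prop where
  /-- `ρ_0^in ∈ C²_b(ℝ²)`. -/
  profile_C2 : ContDiff ℝ 2 ρ0
  profile_bounded : ∃ C : ℝ, ∀ k ≤ 2, ∀ y : Plane, ‖iteratedFDeriv ℝ k ρ0 y‖ ≤ C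
  /-- `0 ≤ ρ_0^in ≤ ρ^*` and `0 ≤ ρ_ε^in ≤ 2 ρ^*`. -/
  density_bounds : ∃ ρs : ℝ, 0 < ρs ∧ (∀ y, 0 ≤ ρ0 y ∧ ρ0 y ≤ ρs) ∧
    ∀ ε ∈ E, ∀ᵐ x ∂(slabMeasure (ℓ ε)),
      0 ≤ initialDensity ρ0 rin ε x ∧ initialDensity ρ0 rin ε x ≤ 2 * ρs
  density_memLp : ∀ ε ∈ E, MemLp (initialDensity ρ0 rin ε) ⊤ (slabMeasure (ℓ ε))
  density_nonvacuum : ∀ ε ∈ E, ∃ δ : ℝ, 0 < δ ∧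
    vacuumIntegral (ℓ ε) (initialDensity ρ0 rin ε) δ < ⊤
  /-- The averages of `r_ε^in` are bounded in `L^∞(ℝ²)` and in `H^{-2}(ℝ²)`, the dual of
  `H²(ℝ²)`. -/
  perturbation_Linfty : ∃ C : ℝ, ∀ ε ∈ E, ∀ᵐ y : Plane, |vAvg (ℓ ε) (rin ε) y| ≤ C
  perturbation_Hneg2 : ∃ C : ℝ, ∀ ε ∈ E, ∀ φ : Plane → ℝ, IsTest φ →
    |∫ y : Plane, vAvg (ℓ ε) (rin ε) y * φ y| ≤ C * normH2 φ
  momentum_memLp : ∀ ε ∈ E, MemLp (m ε) 2 (slabMeasure (ℓ ε))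
  momentum_vacuum : ∀ ε ∈ E, ∀ᵐ x ∂(slabMeasure (ℓ ε)),
    initialDensity ρ0 rin ε x = 0 → m ε x = 0
  momentum_energy : ∀ ε ∈ E,
    Integrable (fun x => ‖m ε x‖ ^ 2 / initialDensity ρ0 rin ε x) (slabMeasure (ℓ ε))
  /-- The averages of `m_ε^in` are bounded in `L²(ℝ²)`. -/
  momentum_avg : ∃ C : ℝ, ∀ ε ∈ E, MemLp (vAvg (ℓ ε) (m ε)) 2 volume ∧
    ∫ y : Plane, ‖vAvg (ℓ ε) (m ε) y‖ ^ 2 ≤ C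
  /-- Uniform bound on the averaged initial energies. -/
  energy_unif : ∃ C : ℝ, ∀ ε ∈ E,
    (2 * ℓ ε)⁻¹ * ∫ x in slab (ℓ ε), ‖m ε x‖ ^ 2 / initialDensity ρ0 rin ε x ≤ C
  nonvacuum_unif : ∃ δ : ℝ, 0 < δ ∧ ∃ C : ℝ, ∀ ε ∈ E,
    (ENNReal.ofReal (2 * ℓ ε))⁻¹ * vacuumIntegral (ℓ ε) (initialDensity ρ0 rin ε) δ
      ≤ ENNReal.ofReal C
  /-- Non-degeneracy of a non-constant profile. -/
  nondegenerate : (¬ ∃ c : ℝ, ∀ y, ρ0 y = c) → ∀ K : Set Plane, IsCompact K →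
    Tendsto (fun δ : ℝ => volume {y ∈ K | ‖gradient ρ0 y‖ ≤ δ}) (𝓝[>] 0) (𝓝 0)

/-- `f_ε ⇀ g` weakly-* in `L^∞([0,T] × ℝ²)` as `ε → 0` in `E`, for a time independent `g`. -/
def TendstoWeakStar (E : Set ℝ) (T : ℝ) (f : ℝ → ℝ → Plane → ℝ) (g : Plane → ℝ) : Prop :=
  (∀ ε ∈ E, MemLp (fun q : ℝ × Plane => f ε q.1 q.2) ⊤ (planeCylMeasure T)) ∧
  ∀ φ : ℝ × Plane → ℝ, Integrable φ (planeCylMeasure T) →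
    Tendsto (fun ε => ∫ q, f ε q.1 q.2 * φ q ∂(planeCylMeasure T)) (𝓝[E] 0)
      (𝓝 (∫ q, g q.2 * φ q ∂(planeCylMeasure T)))

/-- `F_ε → g` in `C⁰([0,T]; L^p_w(K))` as `ε → 0` in `E`, for a time independent `g`: each `F_ε` is
weakly continuous in time with values in `L^p(K)`, and the convergence of the pairings with any
element of the dual `L^q(K)` is uniform in `t ∈ [0,T]`. -/
def TendstoCWeak (E : Set ℝ) (T : ℝ) (K : Set Plane) (p : ℝ≥0∞) (F : ℝ → ℝ → Plane → ℝ)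
    (g : Plane → ℝ) : Prop :=
  (∀ ε ∈ E, ∀ t ∈ Icc 0 T, MemLp (F ε t) p (volume.restrict K)) ∧
  ∀ q : ℝ≥0∞, p.HolderConjugate q → ∀ φ : Plane → ℝ, MemLp φ q (volume.restrict K) →
    (∀ ε ∈ E, ContinuousOn (fun t => ∫ y in K, F ε t y * φ y) (Icc 0 T)) ∧
    TendstoUniformlyOn (fun ε t => ∫ y in K, F ε t y * φ y) (fun _ => ∫ y in K, g y * φ y)
      (𝓝[E] 0) (Icc 0 T)

end

/-! Strong friction stops the fluid, and then the density has nothing to move it.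

Velocity. On a vertical fibre, `u` is controlled by its trace on the upper face, with weight `ℓ`,
and by its vertical derivative, with weight `ℓ²` (`IsTrace.ae_integral_fibre_sq_le`). The initial
energy is `O(ℓ)`, so the energy inequality bounds the dissipation by `O(ℓ)` and the squared trace by
`O(ℓ/α)`. Hence the mean of `|u|²` over the thickness is at most `2C ℓ/α + 8C ℓ²`, which tends to
zero (`IsFiniteEnergyWeakSolution.meanVelocitySq_le`), and Cauchy-Schwarz passes this to the
averages.

Density. Testing the mass equation with functions of `(t, x_h)` gives `∂ₜρ̄ + div_h(avg(ρ u_h)) =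
0`. The maximum principle (`SolvesMass.ae_le`) bounds `ρ` uniformly in `ε`, so the flux is
controlled by the root of the mean square velocity. Tested with a fixed `ψ`, the averaged density
therefore stays, uniformly on `[0,T]`, close to its initial value
(`SolvesMass.exists_representative`), which is itself within `O(ε)` of `ρ0`.

The uniform bound makes the pairings equicontinuous on `L¹`. Countably many test functions then
suffice, both to build the weakly continuous representative and to pass to the limit. -/

/-! ### Product structure of the measures, and countable families of test functions. -/

theorem slabMeasure_eq_prod (ℓ : ℝ) :
    slabMeasure ℓ = (volume : Measure Plane).prod (volume.restrict (Ioo (-ℓ) ℓ)) := by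
  rw [slabMeasure, slab, Measure.volume_eq_prod, ← Measure.prod_restrict, Measure.restrict_univ]

theorem cylMeasure_eq_prod (ℓ T : ℝ) :
    cylMeasure ℓ T = (volume.restrict (Ioo 0 T)).prod (slabMeasure ℓ) := by
  rw [cylMeasure, slabMeasure, Measure.volume_eq_prod, ← Measure.prod_restrict]

theorem planeCylMeasure_eq_prod (T : ℝ) :
    planeCylMeasure T = (volume.restrict (Ioo 0 T)).prod (volume : Measure Plane) := by
  rw [planeCylMeasure, Measure.volume_eq_prod, ← Measure.prod_restrict, Measure.restrict_univ]

instance sigmaFinite_slabMeasure (ℓ : ℝ) : SigmaFinite (slabMeasure ℓ) := by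
  rw [slabMeasure]; infer_instance

theorem IsTest.integrable {X : Type*} [NormedAddCommGroup X] [NormedSpace ℝ X]
    [MeasurableSpace X] [BorelSpace X] {μ : Measure X}
    [IsFiniteMeasureOnCompacts μ] {φ : X → ℝ} (h : IsTest φ) : Integrable φ μ :=
  h.1.continuous.integrable_of_hasCompactSupport h.2

/-- Some sequence of test functions is dense in `L^p`, for `p < ∞`. -/
theorem exists_seq_isTest_dense {X : Type*} [NormedAddCommGroup X] [NormedSpace ℝ X]
    [FiniteDimensional ℝ X] [MeasurableSpace X] [BorelSpace X] (μ : Measure X)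
    [IsFiniteMeasureOnCompacts μ] [SigmaFinite μ] (p : ℝ≥0∞) (hp : p ≠ ⊤) (hp1 : 1 ≤ p) :
    ∃ S : ℕ → X → ℝ, (∀ n, IsTest (S n)) ∧ ∀ f : X → ℝ, MemLp f p μ → ∀ δ : ℝ, 0 < δ →
      ∃ n, eLpNorm (f - S n) p μ ≤ ENNReal.ofReal δ := by
  have : Fact (1 ≤ p) := ⟨hp1⟩
  have : Fact (p ≠ ⊤) := ⟨hp⟩
  have hD := Lp.dense_hasCompactSupport_contDiff (F := ℝ) (μ := μ) hp
  obtain ⟨t, hts, htc, htd⟩ := hD.exists_countable_dense_subset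
  have htn : t.Nonempty := htd.nonempty
  obtain ⟨e, he⟩ := htc.exists_eq_range htn
  have hmem : ∀ n, ∃ g : X → ℝ, e n =ᵐ[μ] g ∧ HasCompactSupport g ∧ ContDiff ℝ ∞ g := by
    intro n
    exact hts (he ▸ mem_range_self n)
  choose S hS using hmem
  refine ⟨S, fun n => ⟨(hS n).2.2, (hS n).2.1⟩, fun f hf δ hδ => ?_⟩
  obtain ⟨g, hg, hgd⟩ := htd.exists_dist_lt hf.toLp hδ
  rw [he] at hg
  obtain ⟨n, rfl⟩ := hg
  refine ⟨n, ?_⟩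
  rw [dist_comm, dist_comm, Lp.dist_def] at hgd
  have h1 : eLpNorm (f - S n) p μ = eLpNorm (⇑(hf.toLp f) - ⇑(e n)) p μ :=
    eLpNorm_congr_ae ((hf.coeFn_toLp.sub (hS n).1).symm)
  rw [h1]
  refine (ENNReal.le_ofReal_iff_toReal_le ?_ hδ.le).2 hgd.le
  exact ((Lp.memLp _).sub (Lp.memLp _)).eLpNorm_ne_top

/-! ### Distributional derivatives in time. -/

theorem continuousOn_primitive_Ici {H : ℝ → ℝ} (hH : ∀ T, 0 < T → IntegrableOn H (Ioo 0 T)) :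
    ContinuousOn (fun t => ∫ s in Ioc 0 t, H s) (Ici 0) := by
  intro t ht
  have h1 : IntegrableOn H (Icc 0 (t + 1)) := by
    rw [integrableOn_Icc_iff_integrableOn_Ioo]
    exact hH _ (by have : (0 : ℝ) ≤ t := ht; linarith)
  have h2 := intervalIntegral.continuousOn_primitive h1
  refine (h2 t ⟨ht, by linarith⟩).mono_of_mem_nhdsWithin ?_
  have : Icc 0 (t + 1) = Ici 0 ∩ Iic (t + 1) := rfl
  rw [this]
  exact inter_mem self_mem_nhdsWithin (mem_nhdsWithin_of_mem_nhds (Iic_mem_nhds (by linarith)))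

/-- Fubini on the triangle `t < s`. It serves as an integration by parts without differentiating the
primitive of a merely integrable function. -/
theorem integral_mul_primitive {T : ℝ} {g H : ℝ → ℝ} (hg : IntegrableOn g (Ioc 0 T))
    (hH : IntegrableOn H (Ioc 0 T)) :
    ∫ s in Ioc 0 T, g s * ∫ t in Ioc 0 s, H t = ∫ t in Ioc 0 T, (∫ s in Ioc t T, g s) * H t := by
  have hprod : Integrable (fun q : ℝ × ℝ => g q.1 * H q.2)
      ((volume.restrict (Ioc 0 T)).prod (volume.restrict (Ioc 0 T))) := hg.mul_prod hH
  have hS : MeasurableSet {q : ℝ × ℝ | q.2 < q.1} := measurableSet_lt measurable_snd measurable_fst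
  have h1 := integral_integral_swap (f := fun s t =>
    ({q : ℝ × ℝ | q.2 < q.1}).indicator (fun q => g q.1 * H q.2) (s, t)) (hprod.indicator hS)
  have e1 : ∀ s ∈ Ioc 0 T, g s * ∫ t in Ioc 0 s, H t = ∫ t in Ioc 0 T,
      ({q : ℝ × ℝ | q.2 < q.1}).indicator (fun q => g q.1 * H q.2) (s, t) := by
    intro s hs
    rw [integral_Ioc_eq_integral_Ioo, ← integral_const_mul]
    rw [← integral_indicator measurableSet_Ioo, ← integral_indicator measurableSet_Ioc]
    congr 1
    ext t
    simp only [indicator, mem_Ioo, mem_Ioc, mem_ofPred_eq]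
    have := hs.2
    split_ifs <;> first | rfl | (exfalso; grind)
  have e2 : ∀ t ∈ Ioc 0 T, (∫ s in Ioc t T, g s) * H t = ∫ s in Ioc 0 T,
      ({q : ℝ × ℝ | q.2 < q.1}).indicator (fun q => g q.1 * H q.2) (s, t) := by
    intro t ht
    rw [← integral_mul_const]
    rw [← integral_indicator measurableSet_Ioc, ← integral_indicator measurableSet_Ioc]
    congr 1
    ext s
    simp only [indicator, mem_Ioc, mem_ofPred_eq]
    have := ht.1
    split_ifs <;> first | rfl | (exfalso; grind)
  rw [setIntegral_congr_fun measurableSet_Ioc e1, setIntegral_congr_fun measurableSet_Ioc e2]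
  exact h1

/-- If `∂ₜ A = H` on `]0,∞[` with `A(0) = a₀` in the sense of distributions, then
`A(t) = a₀ + ∫₀ᵗ H` for almost every `t`. -/
theorem ae_eq_add_primitive {A H : ℝ → ℝ} {a₀ : ℝ}
    (hA : ∀ T, 0 < T → IntegrableOn A (Ioo 0 T)) (hH : ∀ T, 0 < T → IntegrableOn H (Ioo 0 T))
    (h : ∀ θ : ℝ → ℝ, IsTest θ →
      - ∫ t in Ioi (0 : ℝ), (deriv θ t * A t + θ t * H t) = θ 0 * a₀) :
    ∀ᵐ t ∂(volume.restrict (Ioi (0 : ℝ))), A t = a₀ + ∫ s in Ioc 0 t, H s := by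
  have hP := continuousOn_primitive_Ici hH
  have hPint : ∀ T, IntegrableOn (fun t => ∫ s in Ioc 0 t, H s) (Ioo 0 T) := fun T =>
    ((hP.mono Icc_subset_Ici_self).integrableOn_Icc (b := T)).mono_set Ioo_subset_Icc_self
  have hfint : ∀ T, 0 < T → IntegrableOn (fun t => A t - (a₀ + ∫ s in Ioc 0 t, H s)) (Ioo 0 T) :=
    fun T hT => (hA T hT).sub ((integrableOn_const (by simp)).add (hPint T))
  rw [ae_restrict_iff' measurableSet_Ioi]
  have key := isOpen_Ioi.ae_eq_zero_of_integral_contDiff_smul_eq_zero (U := Ioi (0 : ℝ))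
    (f := fun t => A t - (a₀ + ∫ s in Ioc 0 t, H s)) (μ := volume) ?_ ?_
  · filter_upwards [key] with t ht h0
    linarith [ht h0]
  · intro x hx
    refine ⟨Ioo 0 (x + 1), ?_, hfint _ (by have : 0 < x := hx; linarith)⟩
    exact mem_nhdsWithin_of_mem_nhds (Ioo_mem_nhds hx (by linarith))
  · intro g hg hgc hgs
    obtain ⟨T, hT0, hT⟩ : ∃ T, 0 < T ∧ ∀ s, T ≤ s → g s = 0 := by
      obtain ⟨R, hR⟩ := hgc.isCompact.isBounded.subset_closedBall 0
      refine ⟨|R| + 1, by positivity, fun s hs => image_eq_zero_of_notMem_tsupport fun hm => ?_⟩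
      have := hR hm
      rw [mem_closedBall_zero_iff, Real.norm_eq_abs] at this
      linarith [le_abs_self s, le_abs_self R]
    have hg0 : ∀ s, s ≤ 0 → g s = 0 := fun s hs =>
      image_eq_zero_of_notMem_tsupport fun hm => absurd (hgs hm) (by simpa using hs)
    have hgcont := hg.continuous
    -- The primitive vanishes beyond the support of `g`, but in general not at `0`: its value there
    -- is what brings in `a₀`.
    let G : ℝ → ℝ := fun s => ∫ t in T..s, g t
    have hGd : ∀ s, HasDerivAt G (g s) s := fun s =>
      intervalIntegral.integral_hasDerivAt_right (hgcont.intervalIntegrable _ _)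
        (hgcont.stronglyMeasurableAtFilter _ _) hgcont.continuousAt
    have hGs : ContDiff ℝ ∞ G := by
      rw [contDiff_infty_iff_deriv]
      refine ⟨fun s => (hGd s).differentiableAt, ?_⟩
      rw [show deriv G = g from funext fun s => (hGd s).deriv]
      exact hg
    have hGT : ∀ s, T ≤ s → G s = 0 := by
      intro s hs
      refine intervalIntegral.integral_zero_ae (.of_forall fun t ht => ?_)
      rw [uIoc_of_le hs] at ht
      exact hT t ht.1.le
    -- The factor is `1` for `s ≥ -1` and `0` for `s ≤ -2`. It makes the support compact on the side
    -- of negative times, which the equation does not see.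
    let θ : ℝ → ℝ := fun s => Real.smoothTransition (s + 2) * G s
    have hθ : IsTest θ := by
      refine ⟨(Real.smoothTransition.contDiff.comp (contDiff_id.add contDiff_const)).mul hGs, ?_⟩
      refine HasCompactSupport.intro (isCompact_Icc (a := -2) (b := T)) fun s hs => ?_
      rw [mem_Icc, not_and_or, not_le, not_le] at hs
      rcases hs with hs | hs
      · simp only [θ]; rw [Real.smoothTransition.zero_of_nonpos (by linarith), zero_mul]
      · simp only [θ]; rw [hGT s hs.le, mul_zero]
    have hθG : ∀ s, -1 < s → θ s = G s := fun s hs => by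
      simp only [θ]; rw [Real.smoothTransition.one_of_one_le (by linarith), one_mul]
    have hθd : ∀ s, 0 < s → deriv θ s = g s := by
      intro s hs
      rw [← (hGd s).deriv]
      exact Filter.EventuallyEq.deriv_eq
        (eventually_of_mem (Ioi_mem_nhds (by linarith : (-1 : ℝ) < s)) hθG)
    have h1 := h θ hθ
    have hA' : IntegrableOn A (Ioc 0 T) := by
      rw [integrableOn_Ioc_iff_integrableOn_Ioo]; exact hA T hT0
    have hH' : IntegrableOn H (Ioc 0 T) := by
      rw [integrableOn_Ioc_iff_integrableOn_Ioo]; exact hH T hT0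
    have hgi : IntegrableOn g (Ioc 0 T) := (hgcont.integrableOn_Icc).mono_set Ioc_subset_Icc_self
    have hbdd : ∀ {f k : ℝ → ℝ}, Continuous k → IntegrableOn f (Ioc 0 T) →
        IntegrableOn (fun t => k t * f t) (Ioc 0 T) := by
      intro f k hk hf
      rw [← integrableOn_Icc_iff_integrableOn_Ioc] at hf ⊢
      exact hf.continuousOn_mul hk.continuousOn isCompact_Icc
    have hPint' : IntegrableOn (fun t => ∫ s in Ioc 0 t, H s) (Ioc 0 T) := by
      rw [integrableOn_Ioc_iff_integrableOn_Ioo]; exact hPint T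
    have hGneg : ∀ t ∈ Ioc 0 T, G t = - ∫ s in Ioc t T, g s := by
      intro t ht
      simp only [G]
      rw [intervalIntegral.integral_symm, intervalIntegral.integral_of_le ht.2]
    have e1 : ∫ t in Ioi (0 : ℝ), (deriv θ t * A t + θ t * H t)
        = ∫ t in Ioc 0 T, (g t * A t + G t * H t) := by
      rw [setIntegral_eq_of_subset_of_forall_sdiff_eq_zero measurableSet_Ioi
        (Ioc_subset_Ioi_self : Ioc 0 T ⊆ Ioi 0)]
      · refine setIntegral_congr_fun measurableSet_Ioc fun t ht => ?_
        rw [hθd t ht.1, hθG t (by linarith [ht.1])]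
      · intro t ht
        have ht0 : 0 < t := ht.1
        have htT : T ≤ t := by
          by_contra hc
          exact ht.2 ⟨ht0, (not_le.1 hc).le⟩
        rw [hθd t ht0, hθG t (by linarith), hGT t htT, hT t htT]
        ring
    have e2 : ∫ t in Ioc 0 T, G t * H t
        = - ∫ t in Ioc 0 T, g t * ∫ s in Ioc 0 t, H s := by
      rw [integral_mul_primitive hgi hH', ← integral_neg]
      refine setIntegral_congr_fun measurableSet_Ioc fun t ht => ?_
      rw [hGneg t ht]; ring
    have e3 : θ 0 = - ∫ t in Ioc 0 T, g t := by
      rw [hθG 0 (by norm_num)]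
      simp only [G]
      rw [intervalIntegral.integral_symm, intervalIntegral.integral_of_le hT0.le]
    rw [e1, integral_add (hbdd hgcont hA') (hbdd hGs.continuous hH'), e2, e3] at h1
    have e4 : ∫ x, g x • (A x - (a₀ + ∫ s in Ioc 0 x, H s))
        = ∫ x in Ioc 0 T, (g x * A x - (g x * a₀ + g x * ∫ s in Ioc 0 x, H s)) := by
      rw [← setIntegral_eq_integral_of_forall_compl_eq_zero (s := Ioc 0 T)]
      · refine setIntegral_congr_fun measurableSet_Ioc fun t ht => ?_
        simp only [smul_eq_mul]; ring
      · intro t ht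
        have : g t = 0 := by
          rw [mem_Ioc, not_and_or, not_lt, not_le] at ht
          rcases ht with ht | ht
          · exact hg0 t ht
          · exact hT t ht.le
        rw [this, zero_smul]
    have hga : IntegrableOn (fun x => g x * a₀) (Ioc 0 T) := hgi.mul_const a₀
    have hsum : IntegrableOn (fun x => g x * a₀ + g x * ∫ s in Ioc 0 x, H s) (Ioc 0 T) :=
      hga.add (hbdd hgcont hPint')
    rw [e4, integral_sub (hbdd hgcont hA') hsum, integral_add hga (hbdd hgcont hPint'),
      integral_mul_const]
    linarith

/-! ### Bounded densities and their weak-* limits. -/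

/-- `f` is measurable with `0 ≤ f ≤ M` almost everywhere. -/
def IsBetween (M : ℝ) (f : Plane → ℝ) : Prop :=
  AEStronglyMeasurable f volume ∧ ∀ᵐ y, 0 ≤ f y ∧ f y ≤ M

theorem IsBetween.integrable_mul {M : ℝ} {f g : Plane → ℝ} (hf : IsBetween M f)
    (hg : Integrable g) : Integrable (fun y => f y * g y) := by
  refine hg.bdd_mul (c := M) hf.1 ?_
  filter_upwards [hf.2] with y hy
  rw [Real.norm_of_nonneg hy.1]
  exact hy.2

theorem IsBetween.abs_integral_mul_le {M : ℝ} {f g : Plane → ℝ} (hf : IsBetween M f)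
    (hg : Integrable g) : |∫ y, f y * g y| ≤ M * ∫ y, |g y| := by
  rw [← integral_const_mul]
  refine abs_integral_le_integral_abs.trans (integral_mono_ae (hf.integrable_mul hg).abs
    (hg.abs.const_mul M) ?_)
  filter_upwards [hf.2] with y hy
  rw [abs_mul, abs_of_nonneg hy.1]
  exact mul_le_mul_of_nonneg_right hy.2 (abs_nonneg _)

/-- Equicontinuity of the pairings on `L¹`, with a constant that depends on `f` only through `M`.
All the density arguments below rest on it. -/
theorem IsBetween.abs_integral_mul_sub_le {M : ℝ} {f g g' : Plane → ℝ} (hf : IsBetween M f)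
    (hg : Integrable g) (hg' : Integrable g') :
    |(∫ y, f y * g y) - ∫ y, f y * g' y| ≤ M * ∫ y, |g y - g' y| := by
  rw [← integral_sub (hf.integrable_mul hg) (hf.integrable_mul hg')]
  have := hf.abs_integral_mul_le (hg.sub hg')
  simpa only [Pi.sub_apply, mul_sub] using this

/-- Countability matters: each test function yields a balance in time off its own null set, and only
countably many such sets may be discarded together. -/
theorem exists_seq_isTest_dense_integral :
    ∃ S : ℕ → Plane → ℝ, (∀ n, IsTest (S n)) ∧ ∀ g : Plane → ℝ, Integrable g → ∀ δ : ℝ, 0 < δ →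
      ∃ n, ∫ y, |g y - S n y| ≤ δ := by
  obtain ⟨S, hS, hd⟩ := exists_seq_isTest_dense (volume : Measure Plane) 1 (by simp) le_rfl
  refine ⟨S, hS, fun g hg δ hδ => ?_⟩
  obtain ⟨n, hn⟩ := hd g (memLp_one_iff_integrable.2 hg) δ hδ
  refine ⟨n, ?_⟩
  have h1 := integral_norm_eq_lintegral_enorm (hg.sub (hS n).integrable).1
  simp only [Pi.sub_apply, Real.norm_eq_abs] at h1
  rw [h1]
  rw [eLpNorm_one_eq_lintegral_enorm] at hn
  exact ENNReal.toReal_le_of_le_ofReal hδ.le hn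

theorem exists_mul_integral_abs_sub_le {S : ℕ → Plane → ℝ} {M : ℝ} (hM : 0 ≤ M)
    (hd : ∀ g : Plane → ℝ, Integrable g → ∀ δ : ℝ, 0 < δ → ∃ n, ∫ y, |g y - S n y| ≤ δ)
    {g : Plane → ℝ} (hg : Integrable g) {δ : ℝ} (hδ : 0 < δ) :
    ∃ n, M * ∫ y, |g y - S n y| ≤ δ := by
  -- Dividing by `M + 1` rather than `M` covers `M = 0`.
  obtain ⟨n, hn⟩ := hd g hg (δ / (M + 1)) (by positivity)
  refine ⟨n, ?_⟩
  calc M * ∫ y, |g y - S n y| ≤ (M + 1) * (δ / (M + 1)) := by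
        apply mul_le_mul (by linarith) hn (by positivity) (by positivity)
    _ = δ := by field_simp

/-- The weight `(1 + |y|²)⁻¹` is in `L²(ℝ²)` because its square decays like `|y|⁻⁴` and `4 > 2`. -/
theorem integrable_inv_one_add_norm_sq_sq :
    Integrable (fun y : Plane => ((1 + ‖y‖ ^ 2)⁻¹) ^ 2) := by
  have h := integrable_rpow_neg_one_add_norm_sq (E := Plane) (μ := volume) (r := 4)
    (by simp; norm_num)
  refine h.congr (.of_forall fun y => ?_)
  have h0 : (0 : ℝ) < 1 + ‖y‖ ^ 2 := by positivity
  simp only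
  rw [show (-4 / 2 : ℝ) = -((2 : ℕ) : ℝ) by norm_num, Real.rpow_neg h0.le, Real.rpow_natCast,
    inv_pow]

/-- Weak-* limits of densities with values in `[0, M]` are represented by such densities. -/
theorem exists_isBetween_tendsto {ι : Type*} {l : Filter ι} [NeBot l] {f : ι → Plane → ℝ} {M : ℝ}
    (hM : 0 ≤ M) (hf : ∀ᶠ i in l, IsBetween M (f i))
    (hlim : ∀ g : Plane → ℝ, Integrable g → ∃ c, Tendsto (fun i => ∫ y, f i y * g y) l (𝓝 c)) :
    ∃ F : Plane → ℝ, IsBetween M F ∧ ∀ g : Plane → ℝ, Integrable g →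
      Tendsto (fun i => ∫ y, f i y * g y) l (𝓝 (∫ y, F y * g y)) := by
  -- The limit is a functional `Λ` on `L¹`, linear and bounded by `M` times the norm.
  choose! Λ hΛ using hlim
  have hΛ_abs : ∀ g, Integrable g → |Λ g| ≤ M * ∫ y, |g y| := by
    intro g hg
    refine le_of_tendsto (hΛ g hg).abs ?_
    filter_upwards [hf] with i hi using hi.abs_integral_mul_le hg
  have hΛ_congr : ∀ g g', Integrable g → g =ᵐ[volume] g' → Λ g = Λ g' := by
    intro g g' hg h
    refine tendsto_nhds_unique (hΛ g hg) ((hΛ g' (hg.congr h)).congr fun i => ?_)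
    refine integral_congr_ae ?_
    filter_upwards [h] with y hy
    rw [hy]
  have hΛ_add : ∀ g g', Integrable g → Integrable g' →
      Λ (fun y => g y + g' y) = Λ g + Λ g' := by
    intro g g' hg hg'
    refine tendsto_nhds_unique (hΛ _ (hg.add hg')) (((hΛ g hg).add (hΛ g' hg')).congr' ?_)
    filter_upwards [hf] with i hi
    rw [← integral_add (hi.integrable_mul hg) (hi.integrable_mul hg')]
    refine integral_congr_ae (.of_forall fun y => ?_)
    ring
  have hΛ_smul : ∀ (c : ℝ) g, Integrable g → Λ (fun y => c * g y) = c * Λ g := by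
    intro c g hg
    refine tendsto_nhds_unique (hΛ _ (hg.const_mul c)) (((hΛ g hg).const_mul c).congr fun i => ?_)
    rw [← integral_const_mul]
    refine integral_congr_ae (.of_forall fun y => ?_)
    simp only; ring
  -- Since `w` is in `L²`, the map `h ↦ Λ (h w)` is bounded on `L²`. Riesz represents it by some
  -- `k`, and the wanted density is `k / w`: the duality of `L¹` and `L^∞` is obtained from a
  -- Hilbert space.
  let w : Plane → ℝ := fun y => (1 + ‖y‖ ^ 2)⁻¹
  have hw0 : ∀ y, 0 < w y := fun y => by positivity
  have hwc : Continuous w := by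
    refine Continuous.inv₀ (by fun_prop) fun y => ?_
    positivity
  have hw : MemLp w 2 volume :=
    (memLp_two_iff_integrable_sq hwc.aestronglyMeasurable).2 integrable_inv_one_add_norm_sq_sq
  have hinteg : ∀ h : Lp ℝ 2 (volume : Measure Plane), Integrable (fun y => h y * w y) := fun h =>
    (Lp.memLp h).integrable_mul hw
  have hCS : ∀ h : Lp ℝ 2 (volume : Measure Plane),
      ∫ y, |h y * w y| ≤ ‖h‖ * ‖hw.toLp w‖ := by
    intro h
    have h1 := real_inner_le_norm (|h|) (|hw.toLp w|)
    rw [norm_abs_eq_norm, norm_abs_eq_norm, L2.inner_def] at h1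
    refine le_trans (le_of_eq (integral_congr_ae ?_)) h1
    filter_upwards [Lp.coeFn_abs h, Lp.coeFn_abs (hw.toLp w), hw.coeFn_toLp] with y h1 h2 h3
    rw [h1, h2, h3, abs_mul]
    simp [mul_comm]
  let Φ : Lp ℝ 2 (volume : Measure Plane) →ₗ[ℝ] ℝ :=
    { toFun := fun h => Λ (fun y => h y * w y)
      map_add' := by
        intro h h'
        rw [← hΛ_add _ _ (hinteg h) (hinteg h')]
        refine hΛ_congr _ _ (hinteg _) ?_
        filter_upwards [Lp.coeFn_add h h'] with y hy
        rw [hy, Pi.add_apply, add_mul]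
      map_smul' := by
        intro c h
        rw [RingHom.id_apply, smul_eq_mul, ← hΛ_smul c _ (hinteg h)]
        refine hΛ_congr _ _ (hinteg _) ?_
        filter_upwards [Lp.coeFn_smul c h] with y hy
        rw [hy, Pi.smul_apply, smul_eq_mul, mul_assoc] }
  let Φc : StrongDual ℝ (Lp ℝ 2 (volume : Measure Plane)) :=
    Φ.mkContinuous (M * ‖hw.toLp w‖) (by
      intro h
      refine (hΛ_abs _ (hinteg h)).trans ?_
      rw [mul_assoc, mul_comm ‖hw.toLp w‖]
      exact mul_le_mul_of_nonneg_left (hCS h) hM)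
  let k : Lp ℝ 2 (volume : Measure Plane) := (InnerProductSpace.toDual ℝ _).symm Φc
  have hk : ∀ h : Lp ℝ 2 (volume : Measure Plane), inner ℝ k h = Λ (fun y => h y * w y) :=
    fun h => InnerProductSpace.toDual_symm_apply
  have hset : ∀ s : Set Plane, MeasurableSet s → volume s < ⊤ →
      Integrable (s.indicator w) ∧ ∫ y in s, k y = Λ (s.indicator w) := by
    intro s hs hsf
    have hi := indicatorConstLp_coeFn (p := 2) (μ := (volume : Measure Plane)) (hs := hs)
      (hμs := hsf.ne) (c := (1 : ℝ))
    have hae : (fun y => indicatorConstLp 2 hs hsf.ne (1 : ℝ) y * w y)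
        =ᵐ[volume] s.indicator w := by
      filter_upwards [hi] with y hy
      rw [hy]
      by_cases hys : y ∈ s <;> simp [hys]
    refine ⟨(hinteg _).congr hae, ?_⟩
    rw [← L2.inner_indicatorConstLp_one hs hsf.ne, real_inner_comm, hk]
    exact hΛ_congr _ _ (hinteg _) hae
  have hkint : ∀ s, MeasurableSet s → volume s < ⊤ → IntegrableOn k s volume := by
    intro s _ hsf
    have : IsFiniteMeasure (volume.restrict s) := ⟨by simpa using hsf⟩
    exact ((Lp.memLp k).restrict s).integrable (by norm_num)
  have hwint : ∀ s, MeasurableSet s → volume s < ⊤ → IntegrableOn w s volume := by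
    intro s hs hsf
    have := (hset s hs hsf).1
    rwa [integrable_indicator_iff hs] at this
  -- The bounds `0 ≤ k ≤ M w` are read off on sets of finite measure, where the integral of `k` is a
  -- limit of pairings with indicators times `w`.
  have hk0 : 0 ≤ᵐ[volume] k := by
    refine ae_nonneg_of_forall_setIntegral_nonneg_of_sigmaFinite hkint fun s hs hsf => ?_
    rw [(hset s hs hsf).2]
    refine ge_of_tendsto (hΛ _ (hset s hs hsf).1) ?_
    filter_upwards [hf] with i hi
    refine integral_nonneg_of_ae ?_
    filter_upwards [hi.2] with y hy
    exact mul_nonneg hy.1 (indicator_nonneg (fun y _ => (hw0 y).le) y)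
  have hkM : 0 ≤ᵐ[volume] fun y => M * w y - k y := by
    refine ae_nonneg_of_forall_setIntegral_nonneg_of_sigmaFinite
      (fun s hs hsf => ((hwint s hs hsf).const_mul M).sub (hkint s hs hsf)) fun s hs hsf => ?_
    rw [integral_sub ((hwint s hs hsf).const_mul M) (hkint s hs hsf), (hset s hs hsf).2,
      integral_const_mul, sub_nonneg]
    refine (le_abs_self _).trans ((hΛ_abs _ (hset s hs hsf).1).trans (le_of_eq ?_))
    rw [← integral_indicator hs]
    congr 2
    ext y
    exact abs_of_nonneg (indicator_nonneg (fun y _ => (hw0 y).le) y)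
  let F : Plane → ℝ := fun y => k y / w y
  have hF : IsBetween M F := by
    refine ⟨(Lp.aestronglyMeasurable k).div₀ hwc.aestronglyMeasurable, ?_⟩
    filter_upwards [hk0, hkM] with y h1 h2
    exact ⟨div_nonneg h1 (hw0 y).le,
      (div_le_iff₀ (hw0 y)).2 (by linarith [show (0 : ℝ) ≤ _ from h2])⟩
  refine ⟨F, hF, fun g hg => ?_⟩
  have hFtest : ∀ ψ : Plane → ℝ, IsTest ψ → ∫ y, F y * ψ y = Λ ψ := by
    intro ψ hψ
    have hm : MemLp (fun y => ψ y / w y) 2 volume := by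
      refine Continuous.memLp_of_hasCompactSupport
        (hψ.1.continuous.div₀ hwc fun y => (hw0 y).ne') (hψ.2.mono fun y hy => ?_)
      intro h0
      exact hy (by simp [h0])
    have h1 := hk (hm.toLp _)
    rw [L2.inner_def] at h1
    have hae : (fun y => hm.toLp _ y * w y) =ᵐ[volume] ψ := by
      filter_upwards [hm.coeFn_toLp] with y hy
      rw [hy, div_mul_cancel₀ _ (hw0 y).ne']
    rw [← hΛ_congr _ _ (hinteg _) hae, ← h1]
    refine integral_congr_ae ?_
    filter_upwards [hm.coeFn_toLp] with y hy
    rw [hy]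
    simp only [F, RCLike.inner_apply, conj_trivial]
    ring
  have hFg : ∫ y, F y * g y = Λ g := by
    obtain ⟨S, hS, hd⟩ := exists_seq_isTest_dense_integral
    refine eq_of_abs_sub_eq_zero (le_antisymm (le_of_forall_pos_le_add fun δ hδ => ?_)
      (abs_nonneg _))
    obtain ⟨n, h3⟩ := exists_mul_integral_abs_sub_le hM hd hg (show 0 < δ / 2 by positivity)
    have hSi : Integrable (S n) := (hS n).integrable
    have h1 := hF.abs_integral_mul_sub_le hg hSi
    have h2 : |Λ g - Λ (S n)| ≤ M * ∫ y, |g y - S n y| := by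
      refine le_of_tendsto ((hΛ g hg).sub (hΛ _ hSi)).abs ?_
      filter_upwards [hf] with i hi using hi.abs_integral_mul_sub_le hg hSi
    rw [hFtest _ (hS n)] at h1
    rw [abs_le] at h1 h2 ⊢
    constructor <;> linarith [h1.1, h1.2, h2.1, h2.2]
  rw [hFg]
  exact hΛ g hg

/-- A bounded family of densities, defined for almost every time, whose pairings with a dense set of
test functions extend continuously to all times, has a weakly continuous representative. -/
theorem exists_weakly_continuous_representative {f : ℝ → Plane → ℝ} {M : ℝ} (hM : 0 ≤ M)
    {G : Set ℝ} (hG : ∀ᵐ t ∂(volume.restrict (Ioi (0 : ℝ))), t ∈ G)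
    (hf : ∀ t ∈ G, IsBetween M (f t)) {S : ℕ → Plane → ℝ} (hS : ∀ n, IsTest (S n))
    (hd : ∀ g : Plane → ℝ, Integrable g → ∀ δ : ℝ, 0 < δ → ∃ n, ∫ y, |g y - S n y| ≤ δ)
    {c : ℕ → ℝ → ℝ} (hc : ∀ n, ContinuousOn (c n) (Ici 0))
    (hfc : ∀ t ∈ G, ∀ n, ∫ y, f t y * S n y = c n t) (hG0 : G ⊆ Ioi 0) :
    ∃ F : ℝ → Plane → ℝ, (∀ t ∈ G, F t =ᵐ[volume] f t) ∧ (∀ t, 0 ≤ t → IsBetween M (F t)) ∧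
      (∀ t, 0 ≤ t → ∀ n, ∫ y, F t y * S n y = c n t) ∧
      ∀ g : Plane → ℝ, Integrable g → ContinuousOn (fun t => ∫ y, F t y * g y) (Ici 0) := by
  -- A set of full measure in `]0,∞[` accumulates at every `t ≥ 0`, the initial time included.
  have hne : ∀ t, 0 ≤ t → NeBot (𝓝[G] t) := by
    intro t ht
    rw [← mem_closure_iff_nhdsWithin_neBot, Metric.mem_closure_iff]
    intro δ hδ
    rw [ae_restrict_iff' measurableSet_Ioi] at hG
    by_contra hcon
    push Not at hcon
    have hsub : Ioo t (t + δ) ⊆ {s | ¬ (s ∈ Ioi (0 : ℝ) → s ∈ G)} := by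
      intro s hs hs'
      have h1 := hcon s (hs' (lt_of_le_of_lt ht hs.1))
      rw [Real.dist_eq, abs_sub_comm, abs_of_pos (by linarith [hs.1])] at h1
      linarith [hs.2]
    have h2 := measure_mono_null hsub (ae_iff.1 hG)
    rw [Real.volume_Ioo] at h2
    simp at h2
    linarith
  -- Replacing `g` by a nearby `S n` costs an error uniform in time, and the pairing with `S n`
  -- agrees on `G` with the continuous function `c n`.
  have hcauchy : ∀ t, 0 ≤ t → ∀ g : Plane → ℝ, Integrable g →
      ∃ a, Tendsto (fun s => ∫ y, f s y * g y) (𝓝[G] t) (𝓝 a) := by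
    intro t ht g hg
    have := hne t ht
    refine cauchy_map_iff_exists_tendsto.1 (Metric.cauchy_iff.2 ⟨inferInstance, fun δ hδ => ?_⟩)
    obtain ⟨n, h3⟩ := exists_mul_integral_abs_sub_le hM hd hg (show 0 < δ / 4 by positivity)
    have h4 : Tendsto (c n) (𝓝[G] t) (𝓝 (c n t)) :=
      (hc n t ht).mono_left (nhdsWithin_mono _ (hG0.trans Ioi_subset_Ici_self))
    have h5 : ∀ᶠ s in 𝓝[G] t, |(∫ y, f s y * g y) - c n t| < δ / 2 := by
      filter_upwards [self_mem_nhdsWithin, Metric.tendsto_nhds.1 h4 (δ / 4) (by positivity)]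
        with s hs hs'
      have h6 := (hf s hs).abs_integral_mul_sub_le hg (hS n).integrable
      rw [hfc s hs n] at h6
      rw [Real.dist_eq] at hs'
      rw [abs_le] at h6
      rw [abs_lt] at hs' ⊢
      constructor <;> linarith [h6.1, h6.2, hs'.1, hs'.2]
    refine ⟨Metric.ball (c n t) (δ / 2), ?_, ?_⟩
    · rw [mem_map]
      filter_upwards [h5] with s hs
      simpa [Real.dist_eq] using hs
    · intro x hx y hy
      have := dist_triangle_right x y (c n t)
      rw [Metric.mem_ball] at hx hy
      linarith
  have hex : ∀ t, ∃ F : Plane → ℝ, 0 ≤ t → (IsBetween M F ∧ ∀ g : Plane → ℝ, Integrable g →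
      Tendsto (fun s => ∫ y, f s y * g y) (𝓝[G] t) (𝓝 (∫ y, F y * g y))) := by
    intro t
    by_cases ht : 0 ≤ t
    · have := hne t ht
      obtain ⟨F, hF⟩ := exists_isBetween_tendsto (l := 𝓝[G] t) hM
        (eventually_of_mem self_mem_nhdsWithin hf) (hcauchy t ht)
      exact ⟨F, fun _ => hF⟩
    · exact ⟨0, fun h => absurd h ht⟩
  choose F hF using hex
  have hFc : ∀ t, 0 ≤ t → ∀ n, ∫ y, F t y * S n y = c n t := by
    intro t ht n
    have := hne t ht
    have h4 : Tendsto (c n) (𝓝[G] t) (𝓝 (c n t)) :=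
      (hc n t ht).mono_left (nhdsWithin_mono _ (hG0.trans Ioi_subset_Ici_self))
    refine tendsto_nhds_unique ((hF t ht).2 _ (hS n).integrable) (h4.congr' ?_)
    filter_upwards [self_mem_nhdsWithin] with s hs
    exact (hfc s hs n).symm
  refine ⟨F, fun t ht => ?_, fun t ht => (hF t ht).1, hFc, fun g hg => ?_⟩
  · have ht0 : 0 ≤ t := (hG0 ht).le
    have hloc : ∀ k : Plane → ℝ, IsBetween M k → LocallyIntegrable k := by
      intro k hk
      refine (locallyIntegrable_const (M : ℝ)).mono hk.1 ?_
      filter_upwards [hk.2] with y hy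
      rw [Real.norm_of_nonneg hy.1, Real.norm_of_nonneg hM]
      exact hy.2
    -- At times of `G`, `F t` and `f t` have the same pairings with every `S n`, hence, by density,
    -- with every test function.
    refine ae_eq_of_integral_contDiff_smul_eq (hloc _ (hF t ht0).1) (hloc _ (hf t ht))
      fun g hg hgc => ?_
    have hgi : Integrable g := IsTest.integrable ⟨hg, hgc⟩
    simp only [smul_eq_mul, mul_comm (g _)]
    refine eq_of_abs_sub_eq_zero (le_antisymm (le_of_forall_pos_le_add fun δ hδ => ?_)
      (abs_nonneg _))
    obtain ⟨n, h3⟩ := exists_mul_integral_abs_sub_le hM hd hgi (show 0 < δ / 2 by positivity)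
    have h1 := (hF t ht0).1.abs_integral_mul_sub_le hgi (hS n).integrable
    have h2 := (hf t ht).abs_integral_mul_sub_le hgi (hS n).integrable
    rw [hFc t ht0] at h1
    rw [hfc t ht] at h2
    rw [abs_le] at h1 h2 ⊢
    constructor <;> linarith [h1.1, h1.2, h2.1, h2.2]
  -- The pairing with `g` is a uniform limit in time of the continuous functions `c n`.
  · refine continuousOn_of_uniform_approx_of_continuousOn (f := fun t => ∫ y, F t y * g y)
      fun U hU => ?_
    obtain ⟨δ, hδ, hδU⟩ := Metric.mem_uniformity_dist.1 hU
    obtain ⟨n, h3⟩ := exists_mul_integral_abs_sub_le hM hd hg (show 0 < δ / 2 by positivity)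
    refine ⟨c n, hc n, fun t ht => hδU ?_⟩
    have h1 := (hF t ht).1.abs_integral_mul_sub_le hg (hS n).integrable
    rw [hFc t ht] at h1
    rw [Real.dist_eq]
    linarith

/-! ### Square integrable functions: Cauchy-Schwarz and duality. -/

theorem MeasureTheory.MemLp.ae_memLp_prodMk_left {α β F : Type*} [MeasurableSpace α]
    [MeasurableSpace β] [NormedAddCommGroup F] {μ : Measure α} {ν : Measure β} [SFinite μ]
    [SFinite ν] {f : α × β → F} (hf : MemLp f 2 (μ.prod ν)) :
    ∀ᵐ x ∂μ, MemLp (fun y => f (x, y)) 2 ν := by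
  have h1 := (memLp_two_iff_integrable_sq_norm hf.1).1 hf
  filter_upwards [hf.1.prodMk_left, h1.prod_right_ae] with x hx hx'
  exact (memLp_two_iff_integrable_sq_norm hx).2 hx'

theorem integral_mul_le_sqrt_mul_sqrt {α : Type*} [MeasurableSpace α] {μ : Measure α}
    {f g : α → ℝ} (hf : MemLp f 2 μ) (hg : MemLp g 2 μ) :
    ∫ x, f x * g x ∂μ ≤ √(∫ x, f x ^ 2 ∂μ) * √(∫ x, g x ^ 2 ∂μ) := by
  have hn : ∀ {k : α → ℝ} (hk : MemLp k 2 μ), ‖hk.toLp k‖ = √(∫ x, k x ^ 2 ∂μ) := by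
    intro k hk
    rw [eq_comm, Real.sqrt_eq_iff_eq_sq (integral_nonneg fun _ => sq_nonneg _) (norm_nonneg _),
      ← real_inner_self_eq_norm_sq, L2.inner_def]
    refine integral_congr_ae ?_
    filter_upwards [hk.coeFn_toLp] with x hx
    rw [hx]; simp [sq]
  have h1 := real_inner_le_norm (hf.toLp f) (hg.toLp g)
  rw [hn hf, hn hg, L2.inner_def] at h1
  refine le_trans (le_of_eq (integral_congr_ae ?_)) h1
  filter_upwards [hf.coeFn_toLp, hg.coeFn_toLp] with x hx hx'
  rw [hx, hx']; simp [mul_comm]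

/-- The `L²` norm by duality, tested on a sequence only. On the fibres of the slab the duality
bounds come from identities valid off one null set per test function, so no larger family is
available. -/
theorem integral_sq_le_of_forall_dense {α : Type*} [MeasurableSpace α] {μ : Measure α}
    {S : ℕ → α → ℝ} (hS : ∀ n, MemLp (S n) 2 μ)
    (hd : ∀ f : α → ℝ, MemLp f 2 μ → ∀ δ : ℝ, 0 < δ →
      ∃ n, eLpNorm (f - S n) 2 μ ≤ ENNReal.ofReal δ) {f : α → ℝ} (hf : MemLp f 2 μ) {C : ℝ}
    (hC : 0 ≤ C) (h : ∀ n, |∫ x, f x * S n x ∂μ| ≤ C * √(∫ x, S n x ^ 2 ∂μ)) :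
    ∫ x, f x ^ 2 ∂μ ≤ C ^ 2 := by
  have hin : ∀ {k k' : α → ℝ} (hk : MemLp k 2 μ) (hk' : MemLp k' 2 μ),
      inner ℝ (hk.toLp k) (hk'.toLp k') = ∫ x, k x * k' x ∂μ := by
    intro k k' hk hk'
    rw [L2.inner_def]
    refine integral_congr_ae ?_
    filter_upwards [hk.coeFn_toLp, hk'.coeFn_toLp] with x hx hx'
    rw [hx, hx']; simp [mul_comm]
  have hn : ∀ {k : α → ℝ} (hk : MemLp k 2 μ), ‖hk.toLp k‖ ^ 2 = ∫ x, k x ^ 2 ∂μ := by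
    intro k hk
    rw [← real_inner_self_eq_norm_sq, hin hk hk]
    simp only [sq]
  set f' := hf.toLp f with hf'
  have hbound : |inner ℝ f' f'| ≤ C * ‖f'‖ := by
    have hclosed : IsClosed {e : Lp ℝ 2 μ | |inner ℝ f' e| ≤ C * ‖e‖} :=
      isClosed_le (by fun_prop) (by fun_prop)
    refine closure_minimal (s := range fun n => (hS n).toLp (S n)) ?_ hclosed ?_
    · rintro _ ⟨n, rfl⟩
      have h1 := h n
      rw [← hin hf (hS n), ← hn (hS n), Real.sqrt_sq (norm_nonneg _)] at h1
      exact h1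
    · rw [Metric.mem_closure_iff]
      intro δ hδ
      obtain ⟨n, hn⟩ := hd f hf (δ / 2) (by positivity)
      refine ⟨_, mem_range_self n, ?_⟩
      rw [dist_eq_norm, hf', ← MemLp.toLp_sub, Lp.norm_toLp]
      exact (ENNReal.toReal_le_of_le_ofReal (by positivity) hn).trans_lt (by linarith)
  rw [real_inner_self_eq_norm_sq, abs_of_nonneg (sq_nonneg _)] at hbound
  rw [← hn hf, ← hf']
  have h0 := norm_nonneg f'
  have h1 : ‖f'‖ ≤ C := by
    rcases h0.eq_or_lt with h0 | h0
    · rw [← h0]; exact hC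
    · exact le_of_mul_le_mul_right (by rw [← sq]; exact hbound) h0
  gcongr

/-! ### Traces and the vertical Poincaré inequality. -/

theorem IsTest.mul_prod {X Y : Type*} [NormedAddCommGroup X] [NormedSpace ℝ X]
    [NormedAddCommGroup Y] [NormedSpace ℝ Y] {ψ : X → ℝ} {χ : Y → ℝ}
    (hψ : IsTest ψ) (hχ : IsTest χ) : IsTest (fun x : X × Y => ψ x.1 * χ x.2) := by
  refine ⟨(hψ.1.comp contDiff_fst).mul (hχ.1.comp contDiff_snd),
    HasCompactSupport.intro (hψ.2.isCompact.prod hχ.2.isCompact) fun x hx => ?_⟩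
  rw [mem_prod, not_and_or] at hx
  rcases hx with hx | hx
  · rw [image_eq_zero_of_notMem_tsupport hx, zero_mul]
  · rw [image_eq_zero_of_notMem_tsupport hx, mul_zero]

theorem pd_mul_prod (j : Fin 3) {ψ : Plane → ℝ} {χ : ℝ → ℝ} {x : Space3}
    (hψ : DifferentiableAt ℝ ψ x.1) (hχ : DifferentiableAt ℝ χ x.2) :
    pd j (fun x : Space3 => ψ x.1 * χ x.2) x
      = fderiv ℝ ψ x.1 (dir j).1 * χ x.2 + ψ x.1 * (deriv χ x.2 * (dir j).2) := by
  have h1 : HasFDerivAt (fun x : Space3 => ψ x.1) _ x := hψ.hasFDerivAt.comp x hasFDerivAt_fst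
  have h2 : HasFDerivAt (fun x : Space3 => χ x.2) _ x :=
    hχ.hasDerivAt.hasFDerivAt.comp x hasFDerivAt_snd
  rw [pd, (h1.fun_mul h2).fderiv]
  simp
  ring

/-- A test function equal to `1` in a neighbourhood of `[-ℓ, ℓ]`. -/
theorem exists_isTest_eq_one (ℓ : ℝ) :
    ∃ κ : ℝ → ℝ, IsTest κ ∧ ∀ z ∈ Ioo (-ℓ - 1) (ℓ + 1), κ z = 1 := by
  let b : ContDiffBump (0 : ℝ) := ⟨|ℓ| + 1, |ℓ| + 2, by positivity, by linarith⟩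
  refine ⟨b, ⟨b.contDiff, b.hasCompactSupport⟩, fun z hz => b.one_of_mem_closedBall ?_⟩
  rw [mem_closedBall_zero_iff, Real.norm_eq_abs, abs_le]
  constructor <;> simp only [b] <;> linarith [hz.1, hz.2, le_abs_self ℓ]

/-- Supplies the multiplier for Green's formula: vanishing at `-ℓ` it removes the lower trace, its
derivative `η` tests `v`, and its size on the fibre is controlled by the `L¹` norm of `η`. -/
theorem exists_isTest_primitive (ℓ : ℝ) {η : ℝ → ℝ} (hη : IsTest η) :
    ∃ χ : ℝ → ℝ, IsTest χ ∧ χ (-ℓ) = 0 ∧ (∀ z ∈ Ioo (-ℓ) ℓ, deriv χ z = η z) ∧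
      ∀ z ∈ Icc (-ℓ) ℓ, |χ z| ≤ ∫ s in Ioo (-ℓ) ℓ, |η s| := by
  obtain ⟨κ, hκ, hκ1⟩ := exists_isTest_eq_one ℓ
  have hc := hη.1.continuous
  let P : ℝ → ℝ := fun z => ∫ s in (-ℓ)..z, η s
  have hPd : ∀ s, HasDerivAt P (η s) s := fun s =>
    intervalIntegral.integral_hasDerivAt_right (hc.intervalIntegrable _ _)
      (hc.stronglyMeasurableAtFilter _ _) hc.continuousAt
  have hPs : ContDiff ℝ ∞ P := by
    rw [contDiff_infty_iff_deriv]
    refine ⟨fun s => (hPd s).differentiableAt, ?_⟩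
    rw [show deriv P = η from funext fun s => (hPd s).deriv]
    exact hη.1
  have hχP : ∀ z ∈ Ioo (-ℓ - 1) (ℓ + 1), κ z * P z = P z := fun z hz => by
    rw [hκ1 z hz, one_mul]
  refine ⟨fun z => κ z * P z, ⟨hκ.1.mul hPs, hκ.2.mul_right⟩, ?_, fun z hz => ?_, fun z hz => ?_⟩
  · simp [P]
  · rw [← (hPd z).deriv]
    exact Filter.EventuallyEq.deriv_eq (eventually_of_mem
      (Ioo_mem_nhds (by linarith [hz.1]) (by linarith [hz.2])) hχP)
  · simp only [hχP z ⟨by linarith [hz.1], by linarith [hz.2]⟩]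
    refine (intervalIntegral.abs_integral_le_integral_abs hz.1).trans ?_
    rw [intervalIntegral.integral_of_le hz.1, ← integral_Ioc_eq_integral_Ioo]
    exact setIntegral_mono_set (hc.abs.integrableOn_Ioc) (.of_forall fun _ => abs_nonneg _)
      (Ioc_subset_Ioc_right hz.2).eventuallyLE

theorem MeasureTheory.MemLp.locallyIntegrable_integral_slab {ℓ : ℝ} {f : Space3 → ℝ}
    (hf : MemLp f 2 (slabMeasure ℓ)) :
    LocallyIntegrable (fun y : Plane => ∫ z in Ioo (-ℓ) ℓ, f (y, z)) ∧
    ∀ ψ : Plane → ℝ, IsTest ψ → Integrable (fun x : Space3 => ψ x.1 * f x) (slabMeasure ℓ) := by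
  rw [slabMeasure_eq_prod] at *
  constructor
  · rw [locallyIntegrable_iff]
    intro K hK
    have : IsFiniteMeasure ((volume : Measure Plane).restrict K) :=
      ⟨by simpa using hK.measure_lt_top⟩
    have h1 : MemLp f 2 (((volume : Measure Plane).restrict K).prod
        (volume.restrict (Ioo (-ℓ) ℓ))) := by
      refine hf.mono_measure ?_
      exact Measure.prod_mono Measure.restrict_le_self le_rfl
    exact (h1.integrable (by norm_num)).integral_prod_left
  · intro ψ hψ
    have hm : MemLp (fun x : Space3 => ψ x.1) 2
        ((volume : Measure Plane).prod (volume.restrict (Ioo (-ℓ) ℓ))) := by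
      refine MemLp.comp_fst (f := ψ) ?_ _
      exact hψ.1.continuous.memLp_of_hasCompactSupport hψ.2
    exact hm.integrable_mul hf

/-- Integration by parts in the vertical direction, on almost every fibre and for one component. -/
theorem IsTrace.ae_integral_fibre {ℓ : ℝ} {v : Space3 → Vec3}
    {G : Space3 → Fin 3 → Vec3} {γp γm : Plane → Vec3} (h : IsTrace ℓ v G γp γm)
    (hv : MemLp v 2 (slabMeasure ℓ)) (hG : MemLp (fun x => G x 2) 2 (slabMeasure ℓ))
    (hγp : MemLp γp 2 volume) {η χ : ℝ → ℝ} (hη : IsTest η) (hχ : IsTest χ)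
    (hχ0 : χ (-ℓ) = 0) (hχd : ∀ z ∈ Ioo (-ℓ) ℓ, deriv χ z = η z) (i : Fin 3) :
    ∀ᵐ y : Plane, ∫ z in Ioo (-ℓ) ℓ, (η z * v (y, z) i + χ z * G (y, z) 2 i) = χ ℓ * γp y i := by
  have hbd : ∀ {k : ℝ → ℝ} {f : Space3 → Vec3}, IsTest k → MemLp f 2 (slabMeasure ℓ) →
      MemLp (fun x : Space3 => k x.2 • f x) 2 (slabMeasure ℓ) := by
    intro k f hk hf
    obtain ⟨C, hC⟩ := hk.2.exists_bound_of_continuous hk.1.continuous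
    refine MemLp.of_le_mul (c := C) hf ?_ (.of_forall fun x => ?_)
    · exact (hk.1.continuous.comp continuous_snd).aestronglyMeasurable.smul hf.1
    · rw [norm_smul]
      exact mul_le_mul_of_nonneg_right (hC _) (norm_nonneg _)
  have hW : MemLp (fun x : Space3 => η x.2 • v x + χ x.2 • G x 2) 2 (slabMeasure ℓ) :=
    (hbd hη hv).add (hbd hχ hG)
  have hcomp : ∀ {k : Space3 → Vec3}, MemLp k 2 (slabMeasure ℓ) →
      MemLp (fun x => k x i) 2 (slabMeasure ℓ) := by
    intro k hk
    exact (EuclideanSpace.proj (𝕜 := ℝ) i).comp_memLp' hk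
  have hWi : MemLp (fun x : Space3 => η x.2 * v x i + χ x.2 * G x 2 i) 2 (slabMeasure ℓ) := by
    simpa using hcomp hW
  have hγi : MemLp (fun y => γp y i) 2 (volume : Measure Plane) :=
    (EuclideanSpace.proj (𝕜 := ℝ) i).comp_memLp' hγp
  obtain ⟨hloc, hinteg⟩ := hWi.locallyIntegrable_integral_slab
  refine ae_eq_of_integral_contDiff_smul_eq hloc
    ((hγi.locallyIntegrable (by norm_num)).smul (χ ℓ)) fun ψ hψ hψc => ?_
  have hψt : IsTest ψ := ⟨hψ, hψc⟩
  -- Green's formula with a tensor product; as `ψ` is arbitrary, the identity localises to almost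
  -- every fibre.
  have h1 := h (fun x => ψ x.1 * χ x.2) (hψt.mul_prod hχ)
  have hψv : ∀ {f : Space3 → Vec3}, MemLp f 2 (slabMeasure ℓ) →
      Integrable (fun x : Space3 => ψ x.1 • f x) (slabMeasure ℓ) := by
    intro f hf
    have hm : MemLp (fun x : Space3 => ψ x.1) 2 (slabMeasure ℓ) := by
      rw [slabMeasure_eq_prod]
      exact MemLp.comp_fst (f := ψ) (hψ.continuous.memLp_of_hasCompactSupport hψc) _
    exact memLp_one_iff_integrable.1 (hf.smul hm)
  have e1 : ∫ x in slab ℓ, (pd 2 (fun x : Space3 => ψ x.1 * χ x.2) x • v x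
      + (ψ x.1 * χ x.2) • G x 2) = ∫ x, ψ x.1 • (η x.2 • v x + χ x.2 • G x 2) ∂(slabMeasure ℓ) := by
    rw [slabMeasure]
    refine setIntegral_congr_fun (MeasurableSet.univ.prod measurableSet_Ioo) fun x hx => ?_
    rw [pd_mul_prod 2 (hψ.differentiable (by simp)).differentiableAt
      (hχ.1.differentiable (by simp)).differentiableAt, hχd x.2 hx.2]
    simp only [dir, Matrix.cons_val, map_zero, zero_mul, mul_one, zero_add, smul_add, smul_smul]
  rw [e1] at h1
  have h2 := congrArg (EuclideanSpace.proj (𝕜 := ℝ) i) h1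
  -- The lower trace is multiplied by `χ (-ℓ) = 0`, so square integrability of `γp` is enough.
  have hγψ : Integrable (fun y => (ψ y * χ ℓ) • γp y - (ψ y * χ (-ℓ)) • γm y) := by
    simp only [hχ0, mul_zero, zero_smul, sub_zero]
    have hm : MemLp (fun y => ψ y * χ ℓ) 2 volume :=
      (hψ.continuous.mul continuous_const).memLp_of_hasCompactSupport hψc.mul_right
    exact memLp_one_iff_integrable.1 (hγp.smul hm)
  rw [← ContinuousLinearMap.integral_comp_comm _ (hψv hW),
    ← ContinuousLinearMap.integral_comp_comm _ hγψ] at h2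
  have e2 : ∫ x, ψ x.1 * (η x.2 * v x i + χ x.2 * G x 2 i) ∂(slabMeasure ℓ)
      = ∫ y, ψ y • ∫ z in Ioo (-ℓ) ℓ, (η z * v (y, z) i + χ z * G (y, z) 2 i) := by
    have h3 := hinteg ψ hψt
    rw [slabMeasure_eq_prod] at h3 ⊢
    rw [integral_prod _ h3]
    refine integral_congr_ae (.of_forall fun y => ?_)
    simp only [smul_eq_mul, integral_const_mul]
  rw [← e2]
  convert! h2 using 2
  · ext y
    simp [hχ0]; ring

/-- The fibrewise bound of a component by its trace and its vertical derivative. -/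
theorem IsTrace.ae_integral_fibre_sq_le {ℓ : ℝ} (hℓ : 0 < ℓ) {v : Space3 → Vec3}
    {G : Space3 → Fin 3 → Vec3} {γp γm : Plane → Vec3} (h : IsTrace ℓ v G γp γm)
    (hv : MemLp v 2 (slabMeasure ℓ)) (hG : MemLp (fun x => G x 2) 2 (slabMeasure ℓ))
    (hγp : MemLp γp 2 volume) (i : Fin 3) :
    ∀ᵐ y : Plane, ∫ z in Ioo (-ℓ) ℓ, v (y, z) i ^ 2
      ≤ 4 * ℓ * γp y i ^ 2 + 8 * ℓ ^ 2 * ∫ z in Ioo (-ℓ) ℓ, G (y, z) 2 i ^ 2 := by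
  obtain ⟨S, hS, hd⟩ := exists_seq_isTest_dense
    ((volume : Measure ℝ).restrict (Ioo (-ℓ) ℓ)) 2 (by simp) (by norm_num)
  choose χ hχ hχ0 hχd hχb using fun n => exists_isTest_primitive ℓ (hS n)
  have hcomp : ∀ {k : Space3 → Vec3}, MemLp k 2 (slabMeasure ℓ) → ∀ᵐ y : Plane,
      MemLp (fun z => k (y, z) i) 2 (volume.restrict (Ioo (-ℓ) ℓ)) := by
    intro k hk
    rw [slabMeasure_eq_prod] at hk
    exact ((EuclideanSpace.proj (𝕜 := ℝ) i).comp_memLp' hk).ae_memLp_prodMk_left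
  have hae := fun n => h.ae_integral_fibre hv hG hγp (hS n) (hχ n) (hχ0 n) (hχd n) i
  rw [← ae_all_iff] at hae
  filter_upwards [hae, hcomp hv, hcomp hG] with y hy hvy hGy
  have hone : MemLp (fun _ : ℝ => (1 : ℝ)) 2 (volume.restrict (Ioo (-ℓ) ℓ)) := memLp_const 1
  have hvol : ∫ _ in Ioo (-ℓ) ℓ, (1 : ℝ) ^ 2 = 2 * ℓ := by
    simp [hℓ.le]; ring
  have hSm : ∀ n, MemLp (S n) 2 (volume.restrict (Ioo (-ℓ) ℓ)) := fun n =>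
    (hS n).1.continuous.memLp_of_hasCompactSupport (hS n).2
  have hL1 : ∀ {k : ℝ → ℝ}, MemLp k 2 (volume.restrict (Ioo (-ℓ) ℓ)) →
      ∫ z in Ioo (-ℓ) ℓ, |k z| ≤ √(2 * ℓ) * √(∫ z in Ioo (-ℓ) ℓ, k z ^ 2) := by
    intro k hk
    have h1 := integral_mul_le_sqrt_mul_sqrt hone hk.abs
    rw [hvol] at h1
    simpa using h1
  have hGi : IntegrableOn (fun z => G (y, z) 2 i) (Ioo (-ℓ) ℓ) := hGy.integrable (by norm_num)
  -- Both terms of `χ(ℓ) γ - ∫ χ ∂₃v` carry a factor `|χ| ≤ ‖S n‖_{L¹} ≤ √(2ℓ) ‖S n‖_{L²}`, so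
  -- `√(2ℓ) B` bounds the norm of `v` on the fibre by duality.
  set B : ℝ := |γp y i| + ∫ z in Ioo (-ℓ) ℓ, |G (y, z) 2 i| with hB
  have hB0 : 0 ≤ B := by positivity
  have hpair : ∀ n, |∫ z in Ioo (-ℓ) ℓ, v (y, z) i * S n z|
      ≤ (√(2 * ℓ) * B) * √(∫ z in Ioo (-ℓ) ℓ, S n z ^ 2) := by
    intro n
    have hχG : IntegrableOn (fun z => χ n z * G (y, z) 2 i) (Ioo (-ℓ) ℓ) := by
      obtain ⟨C, hC⟩ := (hχ n).2.exists_bound_of_continuous (hχ n).1.continuous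
      exact hGi.bdd_mul (hχ n).1.continuous.aestronglyMeasurable (.of_forall hC)
    have hSv : IntegrableOn (fun z => S n z * v (y, z) i) (Ioo (-ℓ) ℓ) :=
      (hSm n).integrable_mul hvy
    have h1 := hy n
    rw [integral_add hSv hχG] at h1
    have h2 : ∫ z in Ioo (-ℓ) ℓ, v (y, z) i * S n z
        = χ n ℓ * γp y i - ∫ z in Ioo (-ℓ) ℓ, χ n z * G (y, z) 2 i := by
      rw [← h1]
      simp only [mul_comm (v _ _)]
      ring
    have h3 : |∫ z in Ioo (-ℓ) ℓ, χ n z * G (y, z) 2 i|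
        ≤ (∫ z in Ioo (-ℓ) ℓ, |S n z|) * ∫ z in Ioo (-ℓ) ℓ, |G (y, z) 2 i| := by
      rw [← integral_const_mul]
      refine abs_integral_le_integral_abs.trans (setIntegral_mono_on hχG.abs
        (hGi.abs.const_mul _) measurableSet_Ioo fun z hz => ?_)
      rw [abs_mul]
      exact mul_le_mul_of_nonneg_right (hχb n z (Ioo_subset_Icc_self hz)) (abs_nonneg _)
    have h4 : |χ n ℓ * γp y i| ≤ (∫ z in Ioo (-ℓ) ℓ, |S n z|) * |γp y i| := by
      rw [abs_mul]
      exact mul_le_mul_of_nonneg_right (hχb n ℓ ⟨by linarith, le_rfl⟩) (abs_nonneg _)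
    calc |∫ z in Ioo (-ℓ) ℓ, v (y, z) i * S n z|
        ≤ (∫ z in Ioo (-ℓ) ℓ, |S n z|) * B := by
          rw [h2, hB, mul_add]
          exact (abs_sub _ _).trans (add_le_add h4 h3)
      _ ≤ (√(2 * ℓ) * √(∫ z in Ioo (-ℓ) ℓ, S n z ^ 2)) * B :=
          mul_le_mul_of_nonneg_right (hL1 (hSm n)) hB0
      _ = _ := by ring
  have h5 := integral_sq_le_of_forall_dense hSm hd hvy (by positivity) hpair
  have h6 : (∫ z in Ioo (-ℓ) ℓ, |G (y, z) 2 i|) ^ 2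
      ≤ 2 * ℓ * ∫ z in Ioo (-ℓ) ℓ, G (y, z) 2 i ^ 2 := by
    have h7 := pow_le_pow_left₀ (by positivity) (hL1 hGy) 2
    rwa [mul_pow, Real.sq_sqrt (by positivity), Real.sq_sqrt (by positivity)] at h7
  refine h5.trans ?_
  rw [mul_pow, Real.sq_sqrt (by positivity)]
  -- With `(a + b)² ≤ 2a² + 2b²` and `(∫|∂₃v|)² ≤ 2ℓ ∫|∂₃v|²`, the bound `2ℓ B²` produces the
  -- constants `4ℓ` and `8ℓ²`.
  have h8 : B ^ 2 ≤ 2 * γp y i ^ 2 + 2 * (∫ z in Ioo (-ℓ) ℓ, |G (y, z) 2 i|) ^ 2 := by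
    rw [hB, ← sq_abs (γp y i)]
    nlinarith [sq_nonneg (|γp y i| - ∫ z in Ioo (-ℓ) ℓ, |G (y, z) 2 i|)]
  calc 2 * ℓ * B ^ 2 ≤ 2 * ℓ * (2 * γp y i ^ 2
        + 2 * (2 * ℓ * ∫ z in Ioo (-ℓ) ℓ, G (y, z) 2 i ^ 2)) := by gcongr; linarith
    _ = _ := by ring

theorem IsTrace.integral_norm_sq_le {ℓ : ℝ} (hℓ : 0 < ℓ) {v : Space3 → Vec3}
    {G : Space3 → Fin 3 → Vec3} {γp γm : Plane → Vec3} (h : IsTrace ℓ v G γp γm)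
    (hv : MemLp v 2 (slabMeasure ℓ)) (hG : MemLp (fun x => G x 2) 2 (slabMeasure ℓ))
    (hγp : MemLp γp 2 volume) :
    ∫ x, ‖v x‖ ^ 2 ∂(slabMeasure ℓ)
      ≤ 4 * ℓ * (∫ y, ‖γp y‖ ^ 2) + 8 * ℓ ^ 2 * ∫ x, ‖G x 2‖ ^ 2 ∂(slabMeasure ℓ) := by
  have hnorm : ∀ w : Vec3, ‖w‖ ^ 2 = ∑ i, w i ^ 2 := fun w => by
    simp [EuclideanSpace.norm_sq_eq]
  have hsq : ∀ {k : Space3 → Vec3}, MemLp k 2 (slabMeasure ℓ) → ∀ i,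
      Integrable (fun x => k x i ^ 2) ((volume : Measure Plane).prod
        (volume.restrict (Ioo (-ℓ) ℓ))) := by
    intro k hk i
    rw [slabMeasure_eq_prod] at hk
    exact ((EuclideanSpace.proj (𝕜 := ℝ) i).comp_memLp' hk).integrable_sq
  have hγsq : ∀ i, Integrable (fun y => γp y i ^ 2) := fun i =>
    ((EuclideanSpace.proj (𝕜 := ℝ) i).comp_memLp' hγp).integrable_sq
  simp only [hnorm]
  rw [slabMeasure_eq_prod, integral_finsetSum _ fun i _ => hsq hv i,
    integral_finsetSum _ fun i _ => hγsq i, integral_finsetSum _ fun i _ => hsq hG i,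
    Finset.mul_sum, Finset.mul_sum, ← Finset.sum_add_distrib]
  refine Finset.sum_le_sum fun i _ => ?_
  rw [integral_prod _ (hsq hv i), integral_prod _ (hsq hG i), ← integral_const_mul,
    ← integral_const_mul, ← integral_add ((hγsq i).const_mul _)
      ((hsq hG i).integral_prod_left.const_mul _)]
  exact integral_mono_ae (hsq hv i).integral_prod_left (((hγsq i).const_mul _).add
      ((hsq hG i).integral_prod_left.const_mul _)) (h.ae_integral_fibre_sq_le hℓ hv hG hγp i)

/-! ### The energy inequality and the decay of the velocity. -/

theorem cylMeasure_mono {ℓ T T' : ℝ} (h : T ≤ T') : cylMeasure ℓ T ≤ cylMeasure ℓ T' :=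
  Measure.restrict_mono (prod_mono_left (Ioo_subset_Ioo_right h)) le_rfl

theorem planeCylMeasure_mono {T T' : ℝ} (h : T ≤ T') : planeCylMeasure T ≤ planeCylMeasure T' :=
  Measure.restrict_mono (prod_mono_left (Ioo_subset_Ioo_right h)) le_rfl

theorem IsVelocity.integral_norm_sq_le {ℓ : ℝ} (hℓ : 0 < ℓ) {u : ℝ → Space3 → Vec3}
    {Du : ℝ → Space3 → Fin 3 → Vec3} {γp γm : ℝ → Plane → Vec3} (h : IsVelocity ℓ u Du γp γm)
    {T : ℝ} (hT : 0 < T) :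
    ∫ q, ‖u q.1 q.2‖ ^ 2 ∂(cylMeasure ℓ T)
      ≤ 4 * ℓ * (∫ q, ‖γp q.1 q.2‖ ^ 2 ∂(planeCylMeasure T))
        + 8 * ℓ ^ 2 * ∫ q, ‖Du q.1 q.2 2‖ ^ 2 ∂(cylMeasure ℓ T) := by
  have hu := h.memLp T hT
  have hD := h.grad_memLp T hT 2
  have hγ := (h.trace_memLp T hT).1
  rw [cylMeasure_eq_prod] at hu hD ⊢
  rw [planeCylMeasure_eq_prod] at hγ ⊢
  have hu2 := hu.integrable_norm_pow (by norm_num)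
  have hD2 := hD.integrable_norm_pow (by norm_num)
  have hγ2 := hγ.integrable_norm_pow (by norm_num)
  rw [integral_prod _ hu2, integral_prod _ hD2, integral_prod _ hγ2, ← integral_const_mul,
    ← integral_const_mul, ← integral_add (hγ2.integral_prod_left.const_mul _)
      (hD2.integral_prod_left.const_mul _)]
  refine integral_mono_ae hu2.integral_prod_left ((hγ2.integral_prod_left.const_mul _).add
      (hD2.integral_prod_left.const_mul _)) ?_
  filter_upwards [hu.ae_memLp_prodMk_left, hD.ae_memLp_prodMk_left, hγ.ae_memLp_prodMk_left,
    ae_restrict_of_ae_restrict_of_subset Ioo_subset_Ioi_self h.trace] with t h1 h2 h3 h4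
  exact h4.integral_norm_sq_le hℓ h1 h2 h3

theorem EnergyInequality.dissipation_le {ℓ α : ℝ} (hα : 0 ≤ α) {ρin : Space3 → ℝ}
    {m : Space3 → Vec3} {ρ : ℝ → Space3 → ℝ} {u : ℝ → Space3 → Vec3}
    {Du : ℝ → Space3 → Fin 3 → Vec3} {γp γm : ℝ → Plane → Vec3}
    (he : EnergyInequality ℓ α ρin m ρ u Du γp γm) (h : IsVelocity ℓ u Du γp γm)
    (hρ : ∀ T : ℝ, 0 < T → ∀ᵐ q ∂(cylMeasure ℓ T), 0 ≤ ρ q.1 q.2) {T : ℝ} (hT : 0 < T) :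
    (∫ q, ‖Du q.1 q.2 2‖ ^ 2 ∂(cylMeasure ℓ T))
      + 2 * α * (∫ q, ‖γp q.1 q.2‖ ^ 2 ∂(planeCylMeasure T))
      ≤ ∫ x in slab ℓ, ‖m x‖ ^ 2 / ρin x := by
  -- The energy inequality holds only at almost every time, so it is used at some `t` in `]T, T+1[`.
  -- The dissipation up to `t` dominates that up to `T`, and the kinetic energy at `t` is
  -- nonnegative.
  have hsub : Ioo T (T + 1) ⊆ Ioi 0 := fun t ht => hT.trans ht.1
  have hρ' := hρ (T + 1) (by linarith)
  rw [cylMeasure_eq_prod] at hρ'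
  have hρt := Measure.ae_ae_of_ae_prod hρ'
  have hρt' := ae_restrict_of_ae_restrict_of_subset
    (Ioo_subset_Ioo_left hT.le : Ioo T (T + 1) ⊆ Ioo 0 (T + 1)) hρt
  have hne : (ae ((volume : Measure ℝ).restrict (Ioo T (T + 1)))).NeBot := by
    rw [ae_neBot, Ne, Measure.restrict_eq_zero]
    simp
  obtain ⟨t, ⟨het, hρt⟩, htm⟩ := (((ae_restrict_of_ae_restrict_of_subset hsub he).and hρt').and
    (ae_restrict_mem measurableSet_Ioo)).exists
  have ht0 : 0 < t := hsub htm
  have h1 : 0 ≤ ∫ x in slab ℓ, ρ t x * ‖u t x‖ ^ 2 := by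
    refine integral_nonneg_of_ae ?_
    filter_upwards [hρt] with x hx
    exact mul_nonneg hx (sq_nonneg _)
  have hD : ∀ j, Integrable (fun q : ℝ × Space3 => ‖Du q.1 q.2 j‖ ^ 2) (cylMeasure ℓ t) :=
    fun j => (h.grad_memLp t ht0 j).integrable_norm_pow (by norm_num)
  have hDs : Integrable (fun q : ℝ × Space3 => ∑ j, ‖Du q.1 q.2 j‖ ^ 2) (cylMeasure ℓ t) :=
    integrable_finsetSum _ fun j _ => hD j
  have hγp : Integrable (fun q : ℝ × Plane => ‖γp q.1 q.2‖ ^ 2) (planeCylMeasure t) :=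
    (h.trace_memLp t ht0).1.integrable_norm_pow (by norm_num)
  have hγm : Integrable (fun q : ℝ × Plane => ‖γm q.1 q.2‖ ^ 2) (planeCylMeasure t) :=
    (h.trace_memLp t ht0).2.integrable_norm_pow (by norm_num)
  have h2 : ∫ q, ‖Du q.1 q.2 2‖ ^ 2 ∂(cylMeasure ℓ T)
      ≤ ∫ τ in Ioo 0 t, ∫ x in slab ℓ, ∑ j : Fin 3, ‖Du τ x j‖ ^ 2 := by
    have e : ∫ τ in Ioo 0 t, ∫ x in slab ℓ, ∑ j : Fin 3, ‖Du τ x j‖ ^ 2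
        = ∫ q, ∑ j, ‖Du q.1 q.2 j‖ ^ 2 ∂(cylMeasure ℓ t) := by
      rw [cylMeasure_eq_prod] at hDs ⊢
      rw [integral_prod _ hDs]
      rfl
    rw [e]
    refine (integral_mono_measure (cylMeasure_mono htm.1.le) (.of_forall fun _ => sq_nonneg _)
      (hD 2)).trans (integral_mono (hD 2) hDs fun q => ?_)
    exact Finset.single_le_sum (f := fun j => ‖Du q.1 q.2 j‖ ^ 2) (fun j _ => sq_nonneg _)
      (Finset.mem_univ 2)
  have h3 : ∫ q, ‖γp q.1 q.2‖ ^ 2 ∂(planeCylMeasure T)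
      ≤ ∫ τ in Ioo 0 t, ∫ y : Plane, (‖γp τ y‖ ^ 2 + ‖γm τ y‖ ^ 2) := by
    have hs : Integrable (fun q : ℝ × Plane => ‖γp q.1 q.2‖ ^ 2 + ‖γm q.1 q.2‖ ^ 2)
      (planeCylMeasure t) := hγp.add hγm
    have e : ∫ τ in Ioo 0 t, ∫ y : Plane, (‖γp τ y‖ ^ 2 + ‖γm τ y‖ ^ 2)
        = ∫ q, (‖γp q.1 q.2‖ ^ 2 + ‖γm q.1 q.2‖ ^ 2) ∂(planeCylMeasure t) := by
      rw [planeCylMeasure_eq_prod] at hs ⊢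
      rw [integral_prod _ hs]
    rw [e]
    refine (integral_mono_measure (planeCylMeasure_mono htm.1.le) (.of_forall fun _ => sq_nonneg _)
      hγp).trans (integral_mono hγp hs fun q => ?_)
    exact le_add_of_nonneg_right (sq_nonneg _)
  have h4 := mul_le_mul_of_nonneg_left h3 (by positivity : 0 ≤ 2 * α)
  linarith

/-- The vertical mean `(2ℓ)⁻¹ ∫∫ |u|²` over `]0,T[ × Ω`. -/
noncomputable def meanVelocitySq (ℓ T : ℝ) (u : ℝ → Space3 → Vec3) : ℝ :=
  (2 * ℓ)⁻¹ * ∫ q, ‖u q.1 q.2‖ ^ 2 ∂(cylMeasure ℓ T)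

theorem meanVelocitySq_nonneg {ℓ : ℝ} (hℓ : 0 < ℓ) (T : ℝ) (u : ℝ → Space3 → Vec3) :
    0 ≤ meanVelocitySq ℓ T u :=
  mul_nonneg (by positivity) (integral_nonneg fun _ => sq_nonneg _)

/-- The decisive estimate. The energy gives `2ℓC` for the vertical dissipation and `ℓC/α` for the
upper trace; the vertical Poincaré inequality, divided by `2ℓ`, turns these into `8Cℓ²` and `2Cℓ/α`.
-/
theorem IsFiniteEnergyWeakSolution.meanVelocitySq_le {ε ℓ α C : ℝ} (hℓ : 0 < ℓ) (hα : 0 < α)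
    {ρin : Space3 → ℝ} {m : Space3 → Vec3} {ρ : ℝ → Space3 → ℝ} {u : ℝ → Space3 → Vec3}
    (h : IsFiniteEnergyWeakSolution ε ℓ α ρin m ρ u)
    (hC : (2 * ℓ)⁻¹ * ∫ x in slab ℓ, ‖m x‖ ^ 2 / ρin x ≤ C) {T : ℝ} (hT : 0 < T) :
    meanVelocitySq ℓ T u ≤ 2 * C * (α / ℓ)⁻¹ + 8 * C * ℓ ^ 2 := by
  obtain ⟨hρ, -, Du, γp, γm, hv, -, he⟩ := h
  have h1 := he.dissipation_le hα.le hv (fun T hT => (hρ T hT).2) hT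
  have h2 := hv.integral_norm_sq_le hℓ hT
  have hE : ∫ x in slab ℓ, ‖m x‖ ^ 2 / ρin x ≤ 2 * ℓ * C := by
    rwa [inv_mul_le_iff₀ (by positivity)] at hC
  set a := ∫ q, ‖Du q.1 q.2 2‖ ^ 2 ∂(cylMeasure ℓ T)
  set b := ∫ q, ‖γp q.1 q.2‖ ^ 2 ∂(planeCylMeasure T)
  have ha : 0 ≤ a := integral_nonneg fun _ => sq_nonneg _
  have hb : 0 ≤ b := integral_nonneg fun _ => sq_nonneg _
  have ha' : a ≤ 2 * ℓ * C := by
    have : 0 ≤ 2 * α * b := by positivity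
    linarith
  have hb' : b ≤ ℓ * C / α := by
    rw [le_div_iff₀ hα]
    linarith
  rw [meanVelocitySq, inv_mul_le_iff₀ (by positivity)]
  calc _ ≤ 4 * ℓ * b + 8 * ℓ ^ 2 * a := h2
    _ ≤ 4 * ℓ * (ℓ * C / α) + 8 * ℓ ^ 2 * (2 * ℓ * C) := by gcongr
    _ = _ := by field_simp; ring

/-! ### Vertical averages of square integrable fields. -/

/-- Regrouping `(t, (x_h, x_3))` as `((t, x_h), x_3)` makes the vertical average an integral over
the last factor of a product. -/
theorem measurePreserving_prodAssoc_cyl (ℓ T : ℝ) :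
    MeasurePreserving (MeasurableEquiv.prodAssoc : (ℝ × Plane) × ℝ ≃ᵐ ℝ × Space3)
      ((planeCylMeasure T).prod (volume.restrict (Ioo (-ℓ) ℓ))) (cylMeasure ℓ T) := by
  rw [planeCylMeasure_eq_prod, cylMeasure_eq_prod, slabMeasure_eq_prod]
  exact measurePreserving_prodAssoc _ _ _

instance sigmaFinite_planeCylMeasure (T : ℝ) : SigmaFinite (planeCylMeasure T) := by
  rw [planeCylMeasure]; infer_instance

theorem norm_vAvg_sq_le {F : Type*} [NormedAddCommGroup F] [NormedSpace ℝ F] {ℓ : ℝ} (hℓ : 0 < ℓ)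
    {f : Space3 → F} {y : Plane}
    (hf : MemLp (fun z => f (y, z)) 2 (volume.restrict (Ioo (-ℓ) ℓ))) :
    ‖vAvg ℓ f y‖ ^ 2 ≤ (2 * ℓ)⁻¹ * ∫ z in Ioo (-ℓ) ℓ, ‖f (y, z)‖ ^ 2 := by
  have hone : MemLp (fun _ : ℝ => (1 : ℝ)) 2 (volume.restrict (Ioo (-ℓ) ℓ)) := memLp_const 1
  have hvol : ∫ _ in Ioo (-ℓ) ℓ, (1 : ℝ) ^ 2 = 2 * ℓ := by
    simp [hℓ.le]; ring
  have h1 := integral_mul_le_sqrt_mul_sqrt hone hf.norm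
  rw [hvol] at h1
  simp only [one_mul] at h1
  have h2 := pow_le_pow_left₀ (norm_nonneg _) ((norm_integral_le_integral_norm _).trans h1) 2
  rw [mul_pow, Real.sq_sqrt (by positivity),
    Real.sq_sqrt (integral_nonneg fun _ => sq_nonneg _)] at h2
  rw [vAvg, norm_smul, mul_pow, Real.norm_of_nonneg (by positivity)]
  calc _ ≤ (2 * ℓ)⁻¹ ^ 2 * (2 * ℓ * ∫ z in Ioo (-ℓ) ℓ, ‖f (y, z)‖ ^ 2) := by gcongr
    _ = _ := by field_simp

theorem aestronglyMeasurable_vAvg {F : Type*} [NormedAddCommGroup F] [NormedSpace ℝ F]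
    {ℓ T : ℝ} {f : ℝ → Space3 → F}
    (hf : AEStronglyMeasurable (fun q : ℝ × Space3 => f q.1 q.2) (cylMeasure ℓ T)) :
    AEStronglyMeasurable (fun q : ℝ × Plane => vAvg ℓ (f q.1) q.2) (planeCylMeasure T) := by
  have h1 := hf.comp_measurePreserving (measurePreserving_prodAssoc_cyl ℓ T)
  exact h1.integral_prod_right'.const_smul _

theorem memLp_vAvg_and_integral_sq_le {F : Type*} [NormedAddCommGroup F] [NormedSpace ℝ F]
    {ℓ T : ℝ} (hℓ : 0 < ℓ) {f : ℝ → Space3 → F}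
    (hf : MemLp (fun q : ℝ × Space3 => f q.1 q.2) 2 (cylMeasure ℓ T)) :
    MemLp (fun q : ℝ × Plane => vAvg ℓ (f q.1) q.2) 2 (planeCylMeasure T) ∧
      ∫ q, ‖vAvg ℓ (f q.1) q.2‖ ^ 2 ∂(planeCylMeasure T)
        ≤ (2 * ℓ)⁻¹ * ∫ q, ‖f q.1 q.2‖ ^ 2 ∂(cylMeasure ℓ T) := by
  have hm := aestronglyMeasurable_vAvg hf.1
  have h1 := hf.comp_measurePreserving (measurePreserving_prodAssoc_cyl ℓ T)
  have h2 := h1.integrable_norm_pow (by norm_num)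
  have h3 : ∀ᵐ q ∂(planeCylMeasure T), ‖vAvg ℓ (f q.1) q.2‖ ^ 2
      ≤ (2 * ℓ)⁻¹ * ∫ z in Ioo (-ℓ) ℓ, ‖f q.1 (q.2, z)‖ ^ 2 := by
    filter_upwards [h1.ae_memLp_prodMk_left] with q hq
    exact norm_vAvg_sq_le hℓ hq
  have h4 : Integrable (fun q : ℝ × Plane => (2 * ℓ)⁻¹ * ∫ z in Ioo (-ℓ) ℓ, ‖f q.1 (q.2, z)‖ ^ 2)
      (planeCylMeasure T) := h2.integral_prod_left.const_mul _
  have h5 : Integrable (fun q : ℝ × Plane => ‖vAvg ℓ (f q.1) q.2‖ ^ 2) (planeCylMeasure T) := by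
    refine h4.mono' (hm.norm.pow 2) ?_
    filter_upwards [h3] with q hq
    rwa [Real.norm_of_nonneg (sq_nonneg _)]
  refine ⟨(memLp_two_iff_integrable_sq_norm hm).2 h5, (integral_mono_ae h5 h4 h3).trans
    (le_of_eq ?_)⟩
  rw [integral_const_mul, ← (measurePreserving_prodAssoc_cyl ℓ T).integral_comp']
  congr 1
  exact (integral_prod _ h2).symm

theorem eLpNorm_two_eq_ofReal_sqrt {α F : Type*} [MeasurableSpace α] [NormedAddCommGroup F]
    {μ : Measure α} {f : α → F} (hf : MemLp f 2 μ) :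
    eLpNorm f 2 μ = ENNReal.ofReal (√(∫ x, ‖f x‖ ^ 2 ∂μ)) := by
  rw [hf.eLpNorm_eq_integral_rpow_norm (by norm_num) (by norm_num), Real.sqrt_eq_rpow]
  simp

/-! ### The mass balance tested with functions of time and horizontal position. -/

/-- The horizontal directional derivative `w_h · ∇_h ψ`. -/
noncomputable def hDeriv (ψ : Plane → ℝ) (w : Vec3) (y : Plane) : ℝ :=
  w 0 * fderiv ℝ ψ y (EuclideanSpace.single 0 1) + w 1 * fderiv ℝ ψ y (EuclideanSpace.single 1 1)

/-- The sum of the absolute values of the first order partial derivatives of `ψ`. -/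
noncomputable def gradSize (ψ : Plane → ℝ) (y : Plane) : ℝ :=
  |fderiv ℝ ψ y (EuclideanSpace.single 0 1)| + |fderiv ℝ ψ y (EuclideanSpace.single 1 1)|

theorem gradSize_nonneg (ψ : Plane → ℝ) (y : Plane) : 0 ≤ gradSize ψ y := by
  unfold gradSize; positivity

theorem abs_hDeriv_le (ψ : Plane → ℝ) (w : Vec3) (y : Plane) :
    |hDeriv ψ w y| ≤ ‖w‖ * gradSize ψ y := by
  have h : ∀ i, |w i| ≤ ‖w‖ := fun i => PiLp.norm_apply_le w i
  unfold hDeriv gradSize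
  rw [mul_add]
  refine (abs_add_le _ _).trans ?_
  rw [abs_mul, abs_mul]
  gcongr
  · exact h 0
  · exact h 1

theorem IsTest.continuous_fderiv_apply {ψ : Plane → ℝ} (hψ : IsTest ψ) (v : Plane) :
    Continuous (fun y => fderiv ℝ ψ y v) ∧ HasCompactSupport (fun y => fderiv ℝ ψ y v) :=
  ⟨(hψ.1.continuous_fderiv (by simp)).clm_apply continuous_const,
    hψ.2.fderiv_apply ℝ v⟩

theorem IsTest.memLp_gradSize {ψ : Plane → ℝ} (hψ : IsTest ψ) :
    Continuous (gradSize ψ) ∧ MemLp (gradSize ψ) 2 volume := by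
  obtain ⟨h0, h0'⟩ := hψ.continuous_fderiv_apply (EuclideanSpace.single 0 1)
  obtain ⟨h1, h1'⟩ := hψ.continuous_fderiv_apply (EuclideanSpace.single 1 1)
  exact ⟨h0.abs.add h1.abs, (h0.memLp_of_hasCompactSupport h0').abs.add
    (h1.memLp_of_hasCompactSupport h1').abs⟩

theorem SolvesMass.tensor {ℓ : ℝ} {ρin : Space3 → ℝ} {ρ : ℝ → Space3 → ℝ}
    {u : ℝ → Space3 → Vec3} (h : SolvesMass ℓ ρin ρ u) {β : ℝ → ℝ} (hβ : IsC1b β)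
    {θ : ℝ → ℝ} {ψ : Plane → ℝ} (hθ : IsTest θ) (hψ : IsTest ψ) :
    - ∫ t in Ioi (0 : ℝ), ∫ x in slab ℓ, β (ρ t x) *
        (deriv θ t * ψ x.1 + θ t * hDeriv ψ (u t x) x.1)
      = θ 0 * ∫ x in slab ℓ, β (ρin x) * ψ x.1 := by
  -- Functions independent of `x_3` are not compactly supported; a vertical cut-off equal to `1`
  -- near the closed slab makes them so without changing the integrals.
  obtain ⟨κ, hκ, hκ1⟩ := exists_isTest_eq_one ℓ
  have h1 := h β hβ _ (hθ.mul_prod (hψ.mul_prod hκ))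
  have hms : MeasurableSet (slab ℓ) := MeasurableSet.univ.prod measurableSet_Ioo
  have hκx : ∀ x ∈ slab ℓ, κ x.2 = 1 ∧ deriv κ x.2 = 0 := by
    intro x hx
    have hx' : x.2 ∈ Ioo (-ℓ - 1) (ℓ + 1) := ⟨by linarith [hx.2.1], by linarith [hx.2.2]⟩
    refine ⟨hκ1 _ hx', ?_⟩
    rw [Filter.EventuallyEq.deriv_eq (f := fun _ => (1 : ℝ))
      (eventually_of_mem (isOpen_Ioo.mem_nhds hx') hκ1)]
    simp
  have e2 : ∫ x in slab ℓ, β (ρin x) * (θ 0 * (ψ x.1 * κ x.2))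
      = θ 0 * ∫ x in slab ℓ, β (ρin x) * ψ x.1 := by
    rw [← integral_const_mul]
    refine setIntegral_congr_fun hms fun x hx => ?_
    rw [(hκx x hx).1]; ring
  rw [← e2, ← h1]
  congr 1
  refine integral_congr_ae (.of_forall fun t => ?_)
  refine setIntegral_congr_fun hms fun x hx => ?_
  have hψd : DifferentiableAt ℝ ψ x.1 := (hψ.1.differentiable (by simp)).differentiableAt
  have hκd : DifferentiableAt ℝ κ x.2 := (hκ.1.differentiable (by simp)).differentiableAt
  have hpd : ∀ j, pd j (fun y : Space3 => θ t * (ψ y.1 * κ y.2)) x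
      = θ t * fderiv ℝ ψ x.1 (dir j).1 := by
    intro j
    have h2 : pd j (fun y : Space3 => θ t * (ψ y.1 * κ y.2)) x
        = θ t * pd j (fun y : Space3 => ψ y.1 * κ y.2) x := by
      unfold pd
      rw [fderiv_const_mul]
      · rfl
      · exact (hψd.comp x differentiableAt_fst).mul (hκd.comp x differentiableAt_snd)
    rw [h2, pd_mul_prod j hψd hκd, (hκx x hx).1, (hκx x hx).2]
    ring
  simp only
  rw [deriv_mul_const_field, Fin.sum_univ_three, hpd, hpd, hpd, (hκx x hx).1, hDeriv]
  simp only [dir, Matrix.cons_val, map_zero]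
  ring

theorem memLp_comp_fst_cyl {g : Plane → ℝ} (hg : MemLp g 2 volume) (ℓ T : ℝ) :
    MemLp (fun q : ℝ × Space3 => g q.2.1) 2 (cylMeasure ℓ T) := by
  rw [cylMeasure_eq_prod, slabMeasure_eq_prod]
  exact MemLp.comp_snd (f := fun x : Space3 => g x.1) (MemLp.comp_fst hg _) _

theorem integrable_comp_fst_cyl {g : Plane → ℝ} (hg : Integrable g) (ℓ T : ℝ) :
    Integrable (fun q : ℝ × Space3 => g q.2.1) (cylMeasure ℓ T) := by
  rw [cylMeasure_eq_prod, slabMeasure_eq_prod]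
  exact Integrable.comp_snd (f := fun x : Space3 => g x.1) (Integrable.comp_fst hg _) _

theorem integral_comp_fst_cyl {ℓ T : ℝ} (hℓ : 0 < ℓ) (hT : 0 < T) {g : Plane → ℝ} :
    ∫ q, g q.2.1 ∂(cylMeasure ℓ T) = T * (2 * ℓ) * ∫ y, g y := by
  rw [cylMeasure_eq_prod, slabMeasure_eq_prod, integral_fun_snd (f := fun x : Space3 => g x.1),
    integral_fun_fst (f := g)]
  simp [measureReal_def, hT.le, hℓ.le, ← two_mul]
  ring

theorem ae_restrict_Ioi_of_forall_Ioo {P : ℝ → Prop}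
    (h : ∀ T : ℝ, 0 < T → ∀ᵐ t ∂(volume.restrict (Ioo 0 T)), P t) :
    ∀ᵐ t ∂(volume.restrict (Ioi (0 : ℝ))), P t := by
  have hU : Ioi (0 : ℝ) = ⋃ n : ℕ, Ioo 0 ((n : ℝ) + 1) := by
    ext t
    simp only [mem_Ioi, mem_iUnion, mem_Ioo]
    refine ⟨fun ht => ?_, fun ⟨n, hn⟩ => hn.1⟩
    obtain ⟨n, hn⟩ := exists_nat_gt t
    exact ⟨n, ht, by linarith⟩
  rw [hU, ae_restrict_iUnion_iff]
  exact fun n => h _ (by positivity)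

section MassBalance

variable {ℓ : ℝ} {ρin : Space3 → ℝ} {ρ : ℝ → Space3 → ℝ} {u : ℝ → Space3 → Vec3} {β : ℝ → ℝ}
  {ψ : Plane → ℝ}

theorem integrable_renormalized_mul {T C : ℝ}
    (hρ : AEStronglyMeasurable (fun q : ℝ × Space3 => ρ q.1 q.2) (cylMeasure ℓ T))
    (hβ : Continuous β) (hC : ∀ s, |β s| ≤ C) {g : ℝ × Space3 → ℝ}
    (hg : Integrable g (cylMeasure ℓ T)) :
    Integrable (fun q => β (ρ q.1 q.2) * g q) (cylMeasure ℓ T) :=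
  hg.bdd_mul (hβ.comp_aestronglyMeasurable hρ) (.of_forall fun _ => hC _)

theorem integrable_hDeriv {T : ℝ}
    (hu : MemLp (fun q : ℝ × Space3 => u q.1 q.2) 2 (cylMeasure ℓ T)) (hψ : IsTest ψ) :
    Integrable (fun q : ℝ × Space3 => hDeriv ψ (u q.1 q.2) q.2.1) (cylMeasure ℓ T) := by
  have hui : ∀ i, MemLp (fun q : ℝ × Space3 => u q.1 q.2 i) 2 (cylMeasure ℓ T) := fun i =>
    (EuclideanSpace.proj (𝕜 := ℝ) i).comp_memLp' hu
  have hd : ∀ v : Plane, MemLp (fun q : ℝ × Space3 => fderiv ℝ ψ q.2.1 v) 2 (cylMeasure ℓ T) :=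
    fun v => memLp_comp_fst_cyl ((hψ.continuous_fderiv_apply v).1.memLp_of_hasCompactSupport
      (hψ.continuous_fderiv_apply v).2) ℓ T
  exact ((hui 0).integrable_mul (hd _)).add ((hui 1).integrable_mul (hd _))

/-- With test functions `θ(t) ψ(x_h)` and `ψ` fixed, the mass equation is an ordinary differential
equation in the sense of distributions, with its initial value. -/
theorem SolvesMass.ae_balance (h : SolvesMass ℓ ρin ρ u)
    (hρ : ∀ T : ℝ, 0 < T →
      AEStronglyMeasurable (fun q : ℝ × Space3 => ρ q.1 q.2) (cylMeasure ℓ T))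
    (hu : ∀ T : ℝ, 0 < T → MemLp (fun q : ℝ × Space3 => u q.1 q.2) 2 (cylMeasure ℓ T))
    (hβ : IsC1b β) (hψ : IsTest ψ) :
    (∀ T, 0 < T → IntegrableOn
      (fun t => ∫ x, β (ρ t x) * hDeriv ψ (u t x) x.1 ∂(slabMeasure ℓ)) (Ioo 0 T)) ∧
    ∀ᵐ t ∂(volume.restrict (Ioi (0 : ℝ))), ∫ x, β (ρ t x) * ψ x.1 ∂(slabMeasure ℓ)
      = (∫ x, β (ρin x) * ψ x.1 ∂(slabMeasure ℓ)) + ∫ s in Ioc 0 t,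
        ∫ x, β (ρ s x) * hDeriv ψ (u s x) x.1 ∂(slabMeasure ℓ) := by
  obtain ⟨hβ1, C, hC⟩ := id hβ
  have hA : ∀ T, 0 < T → Integrable (fun q : ℝ × Space3 => β (ρ q.1 q.2) * ψ q.2.1)
      ((volume.restrict (Ioo 0 T)).prod (slabMeasure ℓ)) := fun T hT => by
    rw [← cylMeasure_eq_prod]
    exact integrable_renormalized_mul (hρ T hT) hβ1.continuous (fun s => (hC s).1)
      (integrable_comp_fst_cyl hψ.integrable ℓ T)
  have hH : ∀ T, 0 < T → Integrable
      (fun q : ℝ × Space3 => β (ρ q.1 q.2) * hDeriv ψ (u q.1 q.2) q.2.1)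
      ((volume.restrict (Ioo 0 T)).prod (slabMeasure ℓ)) := fun T hT => by
    rw [← cylMeasure_eq_prod]
    exact integrable_renormalized_mul (hρ T hT) hβ1.continuous (fun s => (hC s).1)
      (integrable_hDeriv (hu T hT) hψ)
  refine ⟨fun T hT => (hH T hT).integral_prod_left, ?_⟩
  refine ae_eq_add_primitive (fun T hT => (hA T hT).integral_prod_left)
    (fun T hT => (hH T hT).integral_prod_left) fun θ hθ => ?_
  rw [slabMeasure, ← h.tensor hβ hθ hψ]
  congr 1
  refine integral_congr_ae ?_
  have hall : ∀ᵐ t ∂(volume.restrict (Ioi (0 : ℝ))),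
      Integrable (fun x => β (ρ t x) * ψ x.1) (slabMeasure ℓ) ∧
      Integrable (fun x => β (ρ t x) * hDeriv ψ (u t x) x.1) (slabMeasure ℓ) := by
    refine ae_restrict_Ioi_of_forall_Ioo fun T hT => ?_
    filter_upwards [(hA T hT).prod_right_ae, (hH T hT).prod_right_ae] with t h1 h2 using ⟨h1, h2⟩
  filter_upwards [hall] with t ht
  have h1 := ht.1
  have h2 := ht.2
  rw [slabMeasure] at h1 h2
  rw [← integral_const_mul, ← integral_const_mul, ← integral_add (h1.const_mul _) (h2.const_mul _)]
  refine integral_congr_ae (.of_forall fun x => ?_)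
  simp only
  ring

theorem abs_integral_flux_le {T C : ℝ}
    (hρ : AEStronglyMeasurable (fun q : ℝ × Space3 => ρ q.1 q.2) (cylMeasure ℓ T))
    (hu : MemLp (fun q : ℝ × Space3 => u q.1 q.2) 2 (cylMeasure ℓ T))
    (hβ : Continuous β) (hC : ∀ s, |β s| ≤ C) (hψ : IsTest ψ) {t : ℝ} (ht : t ≤ T) :
    |∫ s in Ioc 0 t, ∫ x, β (ρ s x) * hDeriv ψ (u s x) x.1 ∂(slabMeasure ℓ)|
      ≤ C * ∫ q, ‖u q.1 q.2‖ * gradSize ψ q.2.1 ∂(cylMeasure ℓ T) := by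
  have hinteg := integrable_renormalized_mul hρ hβ hC (integrable_hDeriv hu hψ)
  have hg := hu.norm.integrable_mul (memLp_comp_fst_cyl hψ.memLp_gradSize.2 ℓ T)
  have hC0 : 0 ≤ C := (abs_nonneg _).trans (hC 0)
  have hintt := hinteg.mono_measure (cylMeasure_mono ht)
  rw [integral_Ioc_eq_integral_Ioo]
  have e : ∫ s in Ioo 0 t, ∫ x, β (ρ s x) * hDeriv ψ (u s x) x.1 ∂(slabMeasure ℓ)
      = ∫ q, β (ρ q.1 q.2) * hDeriv ψ (u q.1 q.2) q.2.1 ∂(cylMeasure ℓ t) := by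
    rw [cylMeasure_eq_prod] at hintt ⊢
    rw [integral_prod _ hintt]
  rw [e, ← integral_const_mul]
  refine abs_integral_le_integral_abs.trans ((integral_mono_measure (cylMeasure_mono ht)
    (.of_forall fun _ => abs_nonneg _) hinteg.abs).trans (integral_mono hinteg.abs
    (hg.const_mul C) fun q => ?_))
  simp only [abs_mul]
  exact mul_le_mul (hC _) (abs_hDeriv_le _ _ _) (abs_nonneg _) hC0

end MassBalance

/-! ### The maximum principle. -/

theorem isC1b_smoothTransition_sub (M : ℝ) : IsC1b (fun s => Real.smoothTransition (s - M)) := by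
  have hs : ContDiff ℝ 1 Real.smoothTransition := Real.smoothTransition.contDiff
  have hcd : Continuous (deriv Real.smoothTransition) := hs.continuous_deriv le_rfl
  obtain ⟨C, hC⟩ := (isCompact_Icc (a := (0 : ℝ)) (b := 1)).exists_bound_of_continuousOn
    hcd.continuousOn
  have hd : ∀ s, |deriv Real.smoothTransition s| ≤ max C 0 := by
    intro s
    by_cases h : s ∈ Icc (0 : ℝ) 1
    · exact (hC s h).trans (le_max_left _ _)
    · rw [mem_Icc, not_and_or, not_le, not_le] at h
      have : deriv Real.smoothTransition s = 0 := by
        rcases h with h | h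
        · rw [Filter.EventuallyEq.deriv_eq (f := fun _ => (0 : ℝ)) (eventually_of_mem
            (Iio_mem_nhds h) fun r hr => Real.smoothTransition.zero_of_nonpos (le_of_lt hr))]
          simp
        · rw [Filter.EventuallyEq.deriv_eq (f := fun _ => (1 : ℝ)) (eventually_of_mem
            (Ioi_mem_nhds h) fun r hr => Real.smoothTransition.one_of_one_le (le_of_lt hr))]
          simp
      rw [this, abs_zero]
      exact le_max_right _ _
  refine ⟨hs.comp (contDiff_id.sub contDiff_const), max (max C 0) 1, fun s => ⟨?_, ?_⟩⟩
  · rw [abs_of_nonneg (Real.smoothTransition.nonneg _)]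
    exact (Real.smoothTransition.le_one _).trans (le_max_right _ _)
  · rw [deriv_comp_sub_const]
    exact (hd _).trans (le_max_left _ _)

/-- A function of class `C¹_b` which is the identity on `[0, M]`. -/
theorem exists_isC1b_eq_id (M : ℝ) : ∃ β : ℝ → ℝ, IsC1b β ∧ ∀ s, 0 ≤ s → s ≤ M → β s = s := by
  obtain ⟨κ, hκ, hκ1⟩ := exists_isTest_eq_one M
  have hs : ContDiff ℝ 1 (fun s => κ s * s) := (hκ.1.of_le (by simp)).mul contDiff_id
  have hc : HasCompactSupport (fun s => κ s * s) := hκ.2.mul_right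
  obtain ⟨C, hC⟩ := hc.exists_bound_of_continuous hs.continuous
  obtain ⟨C', hC'⟩ := hc.deriv.exists_bound_of_continuous (hs.continuous_deriv le_rfl)
  refine ⟨_, ⟨hs, max C C', fun s => ⟨(hC s).trans (le_max_left _ _),
    (hC' s).trans (le_max_right _ _)⟩⟩, fun s h0 hM => ?_⟩
  rw [hκ1 s ⟨by linarith, by linarith⟩, one_mul]

/-- Cut-off functions at infinity whose gradients are bounded in `L²` and escape to infinity. -/
theorem exists_cutoff_seq : ∃ (ψ : ℕ → Plane → ℝ) (C : ℝ), (∀ n, IsTest (ψ n)) ∧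
    (∀ n y, 0 ≤ ψ n y) ∧ (∀ y, ∀ᶠ n in atTop, ψ n y = 1) ∧
    (∀ (n : ℕ) y, ‖y‖ < n → gradSize (ψ n) y = 0) ∧ ∀ n, ∫ y, gradSize (ψ n) y ^ 2 ≤ C := by
  let b : ContDiffBump (0 : Plane) := ⟨1, 2, by norm_num, by norm_num⟩
  have hb : IsTest (b : Plane → ℝ) := ⟨b.contDiff, b.hasCompactSupport⟩
  have hpos : ∀ n : ℕ, (0 : ℝ) < n + 1 := fun n => by positivity
  let ψ : ℕ → Plane → ℝ := fun n y => b (((n : ℝ) + 1)⁻¹ • y)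
  have hψ1 : ∀ (n : ℕ) y, ‖y‖ < n + 1 → ψ n y = 1 := by
    intro n y hy
    refine b.one_of_mem_closedBall ?_
    rw [mem_closedBall_zero_iff, norm_smul, Real.norm_of_nonneg (inv_nonneg.2 (hpos n).le),
      inv_mul_le_iff₀ (hpos n)]
    simp only [b]
    linarith
  have hgrad : ∀ n y, gradSize (ψ n) y = ((n : ℝ) + 1)⁻¹ * gradSize b (((n : ℝ) + 1)⁻¹ • y) := by
    intro n y
    have : fderiv ℝ (ψ n) y = ((n : ℝ) + 1)⁻¹ • fderiv ℝ b (((n : ℝ) + 1)⁻¹ • y) :=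
      fderiv_comp_smul _
    unfold gradSize
    rw [this]
    simp only [FunLike.coe_smul, Pi.smul_apply, smul_eq_mul, abs_mul,
      abs_of_nonneg (inv_nonneg.2 (hpos n).le)]
    ring
  refine ⟨ψ, ∫ y, gradSize b y ^ 2, fun n => ⟨?_, ?_⟩, fun n y => b.nonneg, fun y => ?_,
    fun n y hy => ?_, fun n => ?_⟩
  · exact b.contDiff.comp (contDiff_const_smul _)
  · exact b.hasCompactSupport.comp_smul (inv_ne_zero (hpos n).ne')
  · obtain ⟨N, hN⟩ := exists_nat_gt ‖y‖
    filter_upwards [eventually_ge_atTop N] with n hn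
    have : (N : ℝ) ≤ n := by exact_mod_cast hn
    exact hψ1 n y (by linarith)
  · have hev : ψ n =ᶠ[𝓝 y] fun _ => 1 := by
      refine eventually_of_mem (Metric.isOpen_ball.mem_nhds
        (mem_ball_zero_iff.2 (show ‖y‖ < (n : ℝ) + 1 by linarith))) fun x hx => ?_
      exact hψ1 n x (mem_ball_zero_iff.1 hx)
    unfold gradSize
    rw [hev.fderiv_eq]
    simp
  · simp only [hgrad, mul_pow]
    -- The Dirichlet integral is invariant under dilation in dimension two: the Jacobian `(n+1)²`
    -- cancels the squared factor `(n+1)⁻¹` of the gradient.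
    rw [integral_const_mul, Measure.integral_comp_inv_smul volume (fun y => gradSize b y ^ 2)]
    simp only [finrank_euclideanSpace, Fintype.card_fin, smul_eq_mul]
    rw [abs_of_nonneg (by positivity), ← mul_assoc, ← mul_pow, inv_mul_cancel₀ (hpos n).ne']
    simp

/-- The cut-off gradients are bounded in `L²` and live where `|x_h| ≥ n`, so Cauchy-Schwarz leaves
the tail of the `L²` norm of `u`, which vanishes. -/
theorem tendsto_integral_norm_mul_cutoff {ℓ T : ℝ} (hℓ : 0 < ℓ) (hT : 0 < T)
    {u : ℝ → Space3 → Vec3} (hu : MemLp (fun q : ℝ × Space3 => u q.1 q.2) 2 (cylMeasure ℓ T))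
    {ψ : ℕ → Plane → ℝ} {C : ℝ} (hψ : ∀ n, IsTest (ψ n))
    (hψ0 : ∀ (n : ℕ) y, ‖y‖ < n → gradSize (ψ n) y = 0) (hC : ∀ n, ∫ y, gradSize (ψ n) y ^ 2 ≤ C) :
    Tendsto (fun n => ∫ q, ‖u q.1 q.2‖ * gradSize (ψ n) q.2.1 ∂(cylMeasure ℓ T)) atTop (𝓝 0) := by
  let s : ℕ → Set (ℝ × Space3) := fun n => {q | (n : ℝ) ≤ ‖q.2.1‖}
  have hs : ∀ n, MeasurableSet (s n) := fun n =>
    measurableSet_le measurable_const (by fun_prop)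
  have hsq := hu.integrable_norm_pow (by norm_num)
  have hlim : Tendsto (fun n => ∫ q, (s n).indicator (fun q => ‖u q.1 q.2‖ ^ 2) q
      ∂(cylMeasure ℓ T)) atTop (𝓝 (∫ _, (0 : ℝ) ∂(cylMeasure ℓ T))) := by
    refine tendsto_integral_of_dominated_convergence _ (fun n => (hsq.indicator (hs n)).1) hsq
      (fun n => .of_forall fun q => ?_) (.of_forall fun q => ?_)
    · refine (norm_indicator_le_norm_self _ _).trans (le_of_eq ?_)
      exact Real.norm_of_nonneg (sq_nonneg _)
    · refine tendsto_const_nhds.congr' ?_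
      obtain ⟨N, hN⟩ := exists_nat_gt ‖q.2.1‖
      filter_upwards [eventually_ge_atTop N] with n hn
      have : (N : ℝ) ≤ n := by exact_mod_cast hn
      rw [indicator_of_notMem]
      intro (h : (n : ℝ) ≤ ‖q.2.1‖)
      linarith
  rw [integral_zero] at hlim
  have hlim2 : Tendsto (fun n => √(∫ q, (s n).indicator (fun q => ‖u q.1 q.2‖ ^ 2) q
      ∂(cylMeasure ℓ T)) * √(T * (2 * ℓ) * C)) atTop (𝓝 0) := by
    have h1 := (Real.continuous_sqrt.tendsto _).comp hlim
    simpa using h1.mul_const (√(T * (2 * ℓ) * C))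
  refine squeeze_zero (fun n => integral_nonneg fun q => mul_nonneg (norm_nonneg _)
    (gradSize_nonneg _ _)) (fun n => ?_) hlim2
  have hcs := integral_mul_le_sqrt_mul_sqrt (hu.norm.indicator (hs n))
    (memLp_comp_fst_cyl (hψ n).memLp_gradSize.2 ℓ T)
  rw [integral_comp_fst_cyl hℓ hT (g := fun y => gradSize (ψ n) y ^ 2)] at hcs
  have e1 : ∀ q : ℝ × Space3, (s n).indicator (fun q => ‖u q.1 q.2‖) q * gradSize (ψ n) q.2.1
      = ‖u q.1 q.2‖ * gradSize (ψ n) q.2.1 := by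
    intro q
    by_cases hq : q ∈ s n
    · rw [indicator_of_mem hq]
    · rw [indicator_of_notMem hq, hψ0 n _ (not_le.1 hq), mul_zero, mul_zero]
  have e2 : ∀ q : ℝ × Space3, (s n).indicator (fun q => ‖u q.1 q.2‖) q ^ 2
      = (s n).indicator (fun q => ‖u q.1 q.2‖ ^ 2) q := by
    intro q
    by_cases hq : q ∈ s n
    · rw [indicator_of_mem hq, indicator_of_mem hq]
    · rw [indicator_of_notMem hq, indicator_of_notMem hq]; norm_num
  simp only [e1, e2] at hcs
  refine hcs.trans ?_
  gcongr
  exact hC n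

/-- The maximum principle for the density. -/
theorem SolvesMass.ae_le {ℓ M : ℝ} (hℓ : 0 < ℓ) {ρin : Space3 → ℝ} {ρ : ℝ → Space3 → ℝ}
    {u : ℝ → Space3 → Vec3} (h : SolvesMass ℓ ρin ρ u)
    (hρ : ∀ T : ℝ, 0 < T →
      AEStronglyMeasurable (fun q : ℝ × Space3 => ρ q.1 q.2) (cylMeasure ℓ T))
    (hu : ∀ T : ℝ, 0 < T → MemLp (fun q : ℝ × Space3 => u q.1 q.2) 2 (cylMeasure ℓ T))
    (hρin : ∀ᵐ x ∂(slabMeasure ℓ), ρin x ≤ M) :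
    ∀ᵐ t ∂(volume.restrict (Ioi (0 : ℝ))), ∀ᵐ x ∂(slabMeasure ℓ), ρ t x ≤ M := by
  obtain ⟨ψ, C, hψ, hψ_nonneg, hψ1, hψ0, hψC⟩ := exists_cutoff_seq
  -- This renormalisation is zero for `s ≤ M` and positive beyond: the datum contributes nothing,
  -- and it remains to show that `β(ρ)` vanishes.
  set β : ℝ → ℝ := fun s => Real.smoothTransition (s - M) with hβ_def
  have hβ : IsC1b β := isC1b_smoothTransition_sub M
  have hβ0 : ∀ s, 0 ≤ β s := fun s => Real.smoothTransition.nonneg _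
  have hβ1 : ∀ s, |β s| ≤ 1 := fun s => by
    rw [abs_of_nonneg (hβ0 s)]; exact Real.smoothTransition.le_one _
  have hβc : Continuous β := hβ.1.continuous
  refine ae_restrict_Ioi_of_forall_Ioo fun T hT => ?_
  have hbal := ae_all_iff.2 fun n => ae_restrict_of_ae_restrict_of_subset
    (Ioo_subset_Ioi_self : Ioo 0 T ⊆ Ioi 0) (h.ae_balance hρ hu hβ (hψ n)).2
  have hmeas := hρ T hT
  rw [cylMeasure_eq_prod] at hmeas
  have hin : ∀ n, ∫ x, β (ρin x) * ψ n x.1 ∂(slabMeasure ℓ) = 0 := by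
    intro n
    refine integral_eq_zero_of_ae ?_
    filter_upwards [hρin] with x hx
    simp only [hβ_def, Pi.zero_apply]
    rw [Real.smoothTransition.zero_of_nonpos (by linarith), zero_mul]
  filter_upwards [hbal, ae_restrict_mem measurableSet_Ioo, hmeas.prodMk_left] with t ht htm hmt
  have hβt : AEStronglyMeasurable (fun x => β (ρ t x)) (slabMeasure ℓ) :=
    hβc.comp_aestronglyMeasurable hmt
  have hψi : ∀ n, Integrable (fun x : Space3 => β (ρ t x) * ψ n x.1) (slabMeasure ℓ) := by
    intro n
    refine Integrable.bdd_mul ?_ hβt (.of_forall fun x => hβ1 _)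
    rw [slabMeasure_eq_prod]
    exact Integrable.comp_fst (hψ n).integrable _
  have hle : ∀ n, ∫ x, β (ρ t x) * ψ n x.1 ∂(slabMeasure ℓ)
      ≤ ∫ q, ‖u q.1 q.2‖ * gradSize (ψ n) q.2.1 ∂(cylMeasure ℓ T) := by
    intro n
    rw [ht n, hin n, zero_add]
    have := abs_integral_flux_le (hρ T hT) (hu T hT) hβc hβ1 (hψ n) htm.2.le
    rw [one_mul] at this
    exact (le_abs_self _).trans this
  have hlim : Tendsto (fun n => ∫ x, β (ρ t x) * ψ n x.1 ∂(slabMeasure ℓ)) atTop (𝓝 0) :=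
    squeeze_zero (fun n => integral_nonneg fun x => mul_nonneg (hβ0 _) (hψ_nonneg n _)) hle
      (tendsto_integral_norm_mul_cutoff hℓ hT (hu T hT) hψ hψ0 hψC)
  -- Integrability of `β(ρ)` over the unbounded slab is not known beforehand, so the cut-offs are
  -- removed by Fatou's lemma.
  have hfatou : ∫⁻ x, ENNReal.ofReal (β (ρ t x)) ∂(slabMeasure ℓ) = 0 := by
    have h1 : ∀ x : Space3, ENNReal.ofReal (β (ρ t x))
        = liminf (fun n => ENNReal.ofReal (β (ρ t x) * ψ n x.1)) atTop := by
      intro x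
      refine (Tendsto.liminf_eq (tendsto_const_nhds.congr' ?_)).symm
      filter_upwards [hψ1 x.1] with n hn
      rw [hn, mul_one]
    have h2 := lintegral_liminf_le' (μ := slabMeasure ℓ) (u := atTop)
      (f := fun (n : ℕ) (x : Space3) => ENNReal.ofReal (β (ρ t x) * ψ n x.1))
      fun n => (hψi n).1.aemeasurable.ennreal_ofReal
    simp only [← h1] at h2
    have h3 : ∀ n, ∫⁻ x, ENNReal.ofReal (β (ρ t x) * ψ n x.1) ∂(slabMeasure ℓ)
        = ENNReal.ofReal (∫ x, β (ρ t x) * ψ n x.1 ∂(slabMeasure ℓ)) := fun n =>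
      (ofReal_integral_eq_lintegral_ofReal (hψi n)
        (.of_forall fun x => mul_nonneg (hβ0 _) (hψ_nonneg n _))).symm
    have h4 : Tendsto (fun n => ∫⁻ x, ENNReal.ofReal (β (ρ t x) * ψ n x.1) ∂(slabMeasure ℓ))
        atTop (𝓝 0) := by
      simp only [h3]
      simpa using ENNReal.tendsto_ofReal hlim
    rw [h4.liminf_eq] at h2
    exact le_antisymm h2 bot_le
  rw [lintegral_eq_zero_iff' hβt.aemeasurable.ennreal_ofReal] at hfatou
  filter_upwards [hfatou] with x hx
  by_contra hc
  have : 0 < β (ρ t x) := Real.smoothTransition.pos_of_pos (by linarith)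
  simp only [Pi.zero_apply, ENNReal.ofReal_eq_zero] at hx
  linarith

/-! ### The averaged density and its weakly continuous representative. -/

theorem MeasureTheory.MemLp.ae_ae_norm_le {α β F : Type*} [MeasurableSpace α]
    [MeasurableSpace β] [NormedAddCommGroup F] {μ : Measure α} {ν : Measure β} [SFinite ν]
    {f : α × β → F} (hf : MemLp f ⊤ (μ.prod ν)) :
    ∀ᵐ x ∂μ, ∀ᵐ y ∂ν, ‖f (x, y)‖ ≤ (eLpNorm f ⊤ (μ.prod ν)).toReal := by
  have h : ∀ᵐ p ∂(μ.prod ν), ‖f p‖ ≤ (eLpNorm f ⊤ (μ.prod ν)).toReal := by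
    filter_upwards [enorm_ae_le_eLpNormEssSup f (μ.prod ν)] with p hp
    rw [← toReal_enorm]
    exact ENNReal.toReal_mono hf.eLpNorm_ne_top hp
  exact Measure.ae_ae_of_ae_prod h

theorem isBetween_vAvg {ℓ M : ℝ} (hℓ : 0 < ℓ) {f : Space3 → ℝ}
    (hf : AEStronglyMeasurable f (slabMeasure ℓ))
    (hb : ∀ᵐ x ∂(slabMeasure ℓ), 0 ≤ f x ∧ f x ≤ M) :
    IsBetween M (vAvg ℓ f) ∧ ∀ g : Plane → ℝ, Integrable g →
      ∫ x, f x * g x.1 ∂(slabMeasure ℓ) = 2 * ℓ * ∫ y, vAvg ℓ f y * g y := by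
  rw [slabMeasure_eq_prod] at *
  have hfib : ∀ᵐ y : Plane, ∀ᵐ z ∂(volume.restrict (Ioo (-ℓ) ℓ)), 0 ≤ f (y, z) ∧ f (y, z) ≤ M :=
    Measure.ae_ae_of_ae_prod hb
  constructor
  · refine ⟨hf.integral_prod_right'.const_smul (2 * ℓ)⁻¹, ?_⟩
    filter_upwards [hfib, hf.prodMk_left] with y hy hfy
    have h0 : 0 ≤ ∫ z in Ioo (-ℓ) ℓ, f (y, z) := by
      refine integral_nonneg_of_ae ?_
      filter_upwards [hy] with z hz using hz.1
    have hM : ∫ z in Ioo (-ℓ) ℓ, f (y, z) ≤ ∫ _ in Ioo (-ℓ) ℓ, M := by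
      refine integral_mono_of_nonneg ?_ (integrable_const M) ?_
      · filter_upwards [hy] with z hz using hz.1
      · filter_upwards [hy] with z hz using hz.2
    rw [vAvg, smul_eq_mul]
    refine ⟨by positivity, ?_⟩
    rw [inv_mul_le_iff₀ (by positivity)]
    refine hM.trans (le_of_eq ?_)
    simp [hℓ.le, ← two_mul]
  · intro g hg
    have hinteg : Integrable (fun x : Space3 => f x * g x.1)
        ((volume : Measure Plane).prod (volume.restrict (Ioo (-ℓ) ℓ))) := by
      refine Integrable.bdd_mul (c := M) (Integrable.comp_fst hg _) hf ?_
      filter_upwards [hb] with x hx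
      rw [Real.norm_of_nonneg hx.1]
      exact hx.2
    rw [integral_prod _ hinteg, ← integral_const_mul]
    refine integral_congr_ae (.of_forall fun y => ?_)
    simp only [vAvg, smul_eq_mul, integral_mul_const]
    field_simp

theorem ae_abs_vAvg_initialDensity_sub_le {ℓ ε C : ℝ} (hℓ : 0 < ℓ) (hε : 0 < ε)
    {ρ0 : Plane → ℝ} {rin : ℝ → Space3 → ℝ}
    (hm : MemLp (initialDensity ρ0 rin ε) ⊤ (slabMeasure ℓ))
    (hr : ∀ᵐ y : Plane, |vAvg ℓ (rin ε) y| ≤ C) :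
    ∀ᵐ y : Plane, |vAvg ℓ (initialDensity ρ0 rin ε) y - ρ0 y| ≤ ε * C := by
  rw [slabMeasure_eq_prod] at hm
  filter_upwards [hm.ae_ae_norm_le, hm.1.prodMk_left, hr] with y hy hmy hry
  have hi : Integrable (fun z => initialDensity ρ0 rin ε (y, z))
      (volume.restrict (Ioo (-ℓ) ℓ)) :=
    Integrable.mono' (integrable_const _) hmy hy
  -- Integrability of the perturbation on the fibre follows from that of the bounded initial
  -- density, by difference.
  have hri : Integrable (fun z => ε * rin ε (y, z)) (volume.restrict (Ioo (-ℓ) ℓ)) := by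
    refine (hi.sub (integrable_const (ρ0 y))).congr (.of_forall fun z => ?_)
    simp [initialDensity]
  have e : vAvg ℓ (initialDensity ρ0 rin ε) y - ρ0 y = ε * vAvg ℓ (rin ε) y := by
    simp only [vAvg, initialDensity, smul_eq_mul]
    rw [integral_add (integrable_const _) hri, integral_const_mul]
    simp [hℓ.le]
    field_simp
    ring
  rw [e, abs_mul, abs_of_pos hε]
  exact mul_le_mul_of_nonneg_left hry hε.le

/-- The weakly continuous representative of the averaged density, with a quantitative bound of its
deviation from the initial datum. -/
theorem SolvesMass.exists_representative {ℓ M C : ℝ} (hℓ : 0 < ℓ) (hM : 0 ≤ M)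
    {ρin : Space3 → ℝ} {ρ : ℝ → Space3 → ℝ} {u : ℝ → Space3 → Vec3} (h : SolvesMass ℓ ρin ρ u)
    (hρ : ∀ T : ℝ, 0 < T →
      AEStronglyMeasurable (fun q : ℝ × Space3 => ρ q.1 q.2) (cylMeasure ℓ T))
    (hρ0 : ∀ T : ℝ, 0 < T → ∀ᵐ q ∂(cylMeasure ℓ T), 0 ≤ ρ q.1 q.2)
    (hu : ∀ T : ℝ, 0 < T → MemLp (fun q : ℝ × Space3 => u q.1 q.2) 2 (cylMeasure ℓ T))
    (hρin_meas : AEStronglyMeasurable ρin (slabMeasure ℓ))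
    (hρin : ∀ᵐ x ∂(slabMeasure ℓ), 0 ≤ ρin x ∧ ρin x ≤ M)
    {β : ℝ → ℝ} (hβ : IsC1b β) (hβid : ∀ s, 0 ≤ s → s ≤ M → β s = s) (hβC : ∀ s, |β s| ≤ C)
    {S : ℕ → Plane → ℝ} (hS : ∀ n, IsTest (S n))
    (hd : ∀ g : Plane → ℝ, Integrable g → ∀ δ : ℝ, 0 < δ → ∃ n, ∫ y, |g y - S n y| ≤ δ) :
    ∃ F : ℝ → Plane → ℝ,
      (∀ᵐ t ∂(volume.restrict (Ioi (0 : ℝ))), F t =ᵐ[volume] vAvg ℓ (ρ t)) ∧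
      (∀ t, 0 ≤ t → IsBetween M (F t)) ∧
      (∀ g : Plane → ℝ, Integrable g → ContinuousOn (fun t => ∫ y, F t y * g y) (Ici 0)) ∧
      ∀ T, 0 < T → ∀ t ∈ Icc 0 T, ∀ n, |(∫ y, F t y * S n y) - ∫ y, vAvg ℓ ρin y * S n y|
        ≤ C * (√(meanVelocitySq ℓ T u) * √(T * ∫ y, gradSize (S n) y ^ 2)) := by
  let H : ℕ → ℝ → ℝ := fun n s => ∫ x, β (ρ s x) * hDeriv (S n) (u s x) x.1 ∂(slabMeasure ℓ)
  let c : ℕ → ℝ → ℝ := fun n t =>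
    (∫ y, vAvg ℓ ρin y * S n y) + (2 * ℓ)⁻¹ * ∫ s in Ioc 0 t, H n s
  have hbal := fun n => h.ae_balance hρ hu hβ (hS n)
  have hc : ∀ n, ContinuousOn (c n) (Ici 0) := fun n =>
    continuousOn_const.add (continuousOn_const.mul (continuousOn_primitive_Ici (hbal n).1))
  have hbetween : ∀ᵐ t ∂(volume.restrict (Ioi (0 : ℝ))),
      AEStronglyMeasurable (ρ t) (slabMeasure ℓ) ∧
      ∀ᵐ x ∂(slabMeasure ℓ), 0 ≤ ρ t x ∧ ρ t x ≤ M := by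
    have h1 : ∀ᵐ t ∂(volume.restrict (Ioi (0 : ℝ))),
        AEStronglyMeasurable (ρ t) (slabMeasure ℓ) ∧ ∀ᵐ x ∂(slabMeasure ℓ), 0 ≤ ρ t x := by
      refine ae_restrict_Ioi_of_forall_Ioo fun T hT => ?_
      have h2 := hρ T hT
      have h3 := hρ0 T hT
      rw [cylMeasure_eq_prod] at h2 h3
      filter_upwards [h2.prodMk_left, Measure.ae_ae_of_ae_prod h3] with t h4 h5 using ⟨h4, h5⟩
    filter_upwards [h1, h.ae_le hℓ hρ hu (hρin.mono fun x hx => hx.2)] with t h2 h3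
    exact ⟨h2.1, h2.2.and h3⟩
  -- The good times: the bounds hold there, together with the balances for all `n` at once.
  let G : Set ℝ := {t | 0 < t ∧ (IsBetween M (vAvg ℓ (ρ t)) ∧
    ∀ n, ∫ y, vAvg ℓ (ρ t) y * S n y = c n t)}
  have hG : ∀ᵐ t ∂(volume.restrict (Ioi (0 : ℝ))), t ∈ G := by
    filter_upwards [hbetween, ae_all_iff.2 fun n => (hbal n).2,
      ae_restrict_mem measurableSet_Ioi] with t h1 h2 h3
    obtain ⟨h4, h5⟩ := isBetween_vAvg hℓ h1.1 h1.2
    obtain ⟨-, h6⟩ := isBetween_vAvg hℓ hρin_meas hρin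
    refine ⟨h3, h4, fun n => ?_⟩
    -- Between `0` and `M` the renormalisation is the identity, so the renormalised balance is the
    -- balance of the density itself.
    have hcongr : ∀ {f : Space3 → ℝ}, (∀ᵐ x ∂(slabMeasure ℓ), 0 ≤ f x ∧ f x ≤ M) →
        ∫ x, β (f x) * S n x.1 ∂(slabMeasure ℓ) = ∫ x, f x * S n x.1 ∂(slabMeasure ℓ) := by
      intro f hf
      refine integral_congr_ae ?_
      filter_upwards [hf] with x hx
      rw [hβid _ hx.1 hx.2]
    have h7 := h2 n
    rw [hcongr h1.2, hcongr hρin, h5 _ (hS n).integrable, h6 _ (hS n).integrable] at h7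
    have hℓ' : (2 * ℓ) ≠ 0 := by positivity
    simp only [c, H]
    rw [← mul_right_inj' hℓ', h7, mul_add, mul_inv_cancel_left₀ hℓ']
  obtain ⟨F, hF1, hF2, hF3, hF4⟩ := exists_weakly_continuous_representative hM hG
    (fun t ht => ht.2.1) hS hd hc (fun t ht => ht.2.2) (fun t ht => ht.1)
  refine ⟨F, ?_, hF2, hF4, fun T hT t ht n => ?_⟩
  · filter_upwards [hG] with t ht using hF1 t ht
  · have hC0 : 0 ≤ C := (abs_nonneg _).trans (hβC 0)
    rw [hF3 t ht.1 n]
    simp only [c, add_sub_cancel_left, abs_mul]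
    rw [abs_of_nonneg (by positivity : 0 ≤ (2 * ℓ)⁻¹), inv_mul_le_iff₀ (by positivity)]
    refine (abs_integral_flux_le (hρ T hT) (hu T hT) hβ.1.continuous hβC (hS n) ht.2).trans ?_
    have hcs := integral_mul_le_sqrt_mul_sqrt (hu T hT).norm
      (memLp_comp_fst_cyl (hS n).memLp_gradSize.2 ℓ T)
    rw [integral_comp_fst_cyl hℓ hT (g := fun y => gradSize (S n) y ^ 2)] at hcs
    have e : ∫ q, ‖u q.1 q.2‖ ^ 2 ∂(cylMeasure ℓ T) = 2 * ℓ * meanVelocitySq ℓ T u := by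
      rw [meanVelocitySq, mul_inv_cancel_left₀ (by positivity)]
    have hℓ0 : 0 ≤ 2 * ℓ := by positivity
    -- The norms of `u` and of the gradient of `S n` each contribute a factor `√(2ℓ)`; together they
    -- compensate the `(2ℓ)⁻¹` of the average, so the bound depends on `ℓ` only through the mean
    -- velocity.
    rw [e, mul_comm T (2 * ℓ), mul_assoc (2 * ℓ) T, Real.sqrt_mul hℓ0,
      Real.sqrt_mul hℓ0 (T * _)] at hcs
    calc _ ≤ C * (√(2 * ℓ) * √(meanVelocitySq ℓ T u)
          * (√(2 * ℓ) * √(T * ∫ y, gradSize (S n) y ^ 2))) := mul_le_mul_of_nonneg_left hcs hC0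
      _ = (√(2 * ℓ) * √(2 * ℓ)) * (C * (√(meanVelocitySq ℓ T u)
          * √(T * ∫ y, gradSize (S n) y ^ 2))) := by ring
      _ = _ := by rw [Real.mul_self_sqrt (by positivity)]

theorem memLp_top_vAvg {ℓ T : ℝ} (hℓ : 0 < ℓ) {f : ℝ → Space3 → ℝ}
    (hf : MemLp (fun q : ℝ × Space3 => f q.1 q.2) ⊤ (cylMeasure ℓ T)) :
    MemLp (fun q : ℝ × Plane => vAvg ℓ (f q.1) q.2) ⊤ (planeCylMeasure T) := by
  have h1 := hf.comp_measurePreserving (measurePreserving_prodAssoc_cyl ℓ T)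
  obtain ⟨C, hC⟩ : ∃ C : ℝ, ∀ᵐ q ∂(planeCylMeasure T), ∀ᵐ z ∂(volume.restrict (Ioo (-ℓ) ℓ)),
      ‖f q.1 (q.2, z)‖ ≤ C := ⟨_, h1.ae_ae_norm_le⟩
  refine memLp_top_of_bound (aestronglyMeasurable_vAvg hf.1) C ?_
  filter_upwards [hC] with q hq
  have h2 := norm_integral_le_of_norm_le (integrable_const _) hq
  rw [vAvg, norm_smul, Real.norm_of_nonneg (by positivity), inv_mul_le_iff₀ (by positivity)]
  refine h2.trans (le_of_eq ?_)
  simp [hℓ.le, ← two_mul]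

/-! ### Passage to the limit. -/

/-- Uniform convergence of the pairings with `L¹` functions, from convergence of the pairings with
test functions. -/
theorem tendstoUniformlyOn_pairing {E : Set ℝ} {T M : ℝ} (hM : 0 ≤ M) {F : ℝ → ℝ → Plane → ℝ}
    {f : ℝ → Plane → ℝ} {ρ0 : Plane → ℝ} (hF : ∀ ε ∈ E, ∀ t, 0 ≤ t → IsBetween M (F ε t))
    (hρ0 : IsBetween M ρ0) {S : ℕ → Plane → ℝ} (hS : ∀ n, IsTest (S n))
    (hd : ∀ g : Plane → ℝ, Integrable g → ∀ δ : ℝ, 0 < δ → ∃ n, ∫ y, |g y - S n y| ≤ δ)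
    {e e' : ℕ → ℝ → ℝ} (he : ∀ n, Tendsto (e n) (𝓝[E] 0) (𝓝 0))
    (he' : ∀ n, Tendsto (e' n) (𝓝[E] 0) (𝓝 0))
    (hFf : ∀ ε ∈ E, ∀ t ∈ Icc 0 T, ∀ n,
      |(∫ y, F ε t y * S n y) - ∫ y, f ε y * S n y| ≤ e n ε)
    (hfρ : ∀ ε ∈ E, ∀ n, |(∫ y, f ε y * S n y) - ∫ y, ρ0 y * S n y| ≤ e' n ε)
    {g : Plane → ℝ} (hg : Integrable g) :
    TendstoUniformlyOn (fun ε t => ∫ y, F ε t y * g y) (fun _ => ∫ y, ρ0 y * g y) (𝓝[E] 0)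
      (Icc 0 T) := by
  rw [Metric.tendstoUniformlyOn_iff]
  intro δ hδ
  -- Four errors of at most `δ/5` each: `g` against `S n` for `F` and for `ρ0`, the deviation from
  -- the initial datum, and the deviation of that datum from `ρ0`.
  obtain ⟨n, hn⟩ := exists_mul_integral_abs_sub_le hM hd hg (show 0 < δ / 5 by positivity)
  filter_upwards [(he n).eventually_lt_const (show 0 < δ / 5 by positivity),
    (he' n).eventually_lt_const (show 0 < δ / 5 by positivity), self_mem_nhdsWithin]
    with ε h1 h2 hε t ht
  have h3 := (hF ε hε t ht.1).abs_integral_mul_sub_le hg (hS n).integrable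
  have h4 := hρ0.abs_integral_mul_sub_le hg (hS n).integrable
  have h5 := hFf ε hε t ht n
  have h6 := hfρ ε hε n
  rw [Real.dist_eq, abs_lt]
  rw [abs_le] at h3 h4 h5 h6
  constructor <;> linarith [h3.1, h3.2, h4.1, h4.2, h5.1, h5.2, h6.1, h6.2]

/-- Weak-* convergence of functions whose weakly continuous representatives converge. -/
theorem tendsto_integral_planeCyl {E : Set ℝ} {T M : ℝ} {F f : ℝ → ℝ → Plane → ℝ}
    {ρ0 : Plane → ℝ} (hF : ∀ ε ∈ E, ∀ t, 0 ≤ t → IsBetween M (F ε t)) (hρ0 : IsBetween M ρ0)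
    (hf : ∀ ε ∈ E, MemLp (fun q : ℝ × Plane => f ε q.1 q.2) ⊤ (planeCylMeasure T))
    (hFf : ∀ ε ∈ E, ∀ᵐ t ∂(volume.restrict (Ioi (0 : ℝ))), F ε t =ᵐ[volume] f ε t)
    (hlim : ∀ g : Plane → ℝ, Integrable g → ∀ t ∈ Ioo 0 T,
      Tendsto (fun ε => ∫ y, F ε t y * g y) (𝓝[E] 0) (𝓝 (∫ y, ρ0 y * g y)))
    {φ : ℝ × Plane → ℝ} (hφ : Integrable φ (planeCylMeasure T)) :
    Tendsto (fun ε => ∫ q, f ε q.1 q.2 * φ q ∂(planeCylMeasure T)) (𝓝[E] 0)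
      (𝓝 (∫ q, ρ0 q.2 * φ q ∂(planeCylMeasure T))) := by
  have hfφ : ∀ ε ∈ E, Integrable (fun q : ℝ × Plane => f ε q.1 q.2 * φ q) (planeCylMeasure T) :=
    fun ε hε => memLp_one_iff_integrable.1
      ((memLp_one_iff_integrable.2 hφ).mul (hf ε hε))
  have hρφ : Integrable (fun q : ℝ × Plane => ρ0 q.2 * φ q) (planeCylMeasure T) := by
    have hb : ∀ᵐ q ∂(planeCylMeasure T), 0 ≤ ρ0 q.2 ∧ ρ0 q.2 ≤ M := by
      rw [planeCylMeasure_eq_prod]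
      exact Measure.quasiMeasurePreserving_snd.ae hρ0.2
    refine hφ.bdd_mul (c := M) ?_ ?_
    · rw [planeCylMeasure_eq_prod]
      exact hρ0.1.comp_snd
    · filter_upwards [hb] with q hq
      rw [Real.norm_of_nonneg hq.1]
      exact hq.2
  rw [planeCylMeasure_eq_prod] at *
  rw [integral_prod _ hρφ]
  -- Each time slice of `φ` is an `L¹` function, to which the convergence at fixed time applies;
  -- domination by `M ∫|φ(t,·)|` allows integration in time.
  have hconv : Tendsto (fun ε => ∫ t in Ioo 0 T, ∫ y, F ε t y * φ (t, y)) (𝓝[E] 0)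
      (𝓝 (∫ t in Ioo 0 T, ∫ y, ρ0 y * φ (t, y))) := by
    refine tendsto_integral_filter_of_dominated_convergence (fun t => M * ∫ y, |φ (t, y)|) ?_ ?_
      (hφ.abs.integral_prod_left.const_mul M) ?_
    · filter_upwards [self_mem_nhdsWithin] with ε hε
      refine (hfφ ε hε).integral_prod_left.1.congr ?_
      filter_upwards [ae_restrict_of_ae_restrict_of_subset Ioo_subset_Ioi_self (hFf ε hε)]
        with t ht
      refine integral_congr_ae ?_
      filter_upwards [ht] with y hy
      rw [hy]
    · filter_upwards [self_mem_nhdsWithin] with ε hε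
      filter_upwards [hφ.prod_right_ae, ae_restrict_mem measurableSet_Ioo] with t h1 h2
      exact (hF ε hε t h2.1.le).abs_integral_mul_le h1
    · filter_upwards [hφ.prod_right_ae, ae_restrict_mem measurableSet_Ioo] with t h1 h2
      exact hlim _ h1 t h2
  refine hconv.congr' ?_
  filter_upwards [self_mem_nhdsWithin] with ε hε
  rw [integral_prod _ (hfφ ε hε)]
  refine integral_congr_ae ?_
  filter_upwards [ae_restrict_of_ae_restrict_of_subset Ioo_subset_Ioi_self (hFf ε hε)] with t ht
  refine integral_congr_ae ?_
  filter_upwards [ht] with y hy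
  rw [hy]

theorem tendstoCWeak_of_pairing {E : Set ℝ} {T M : ℝ} {F : ℝ → ℝ → Plane → ℝ}
    {ρ0 : Plane → ℝ} (hF : ∀ ε ∈ E, ∀ t, 0 ≤ t → IsBetween M (F ε t))
    (hcont : ∀ ε ∈ E, ∀ g : Plane → ℝ, Integrable g →
      ContinuousOn (fun t => ∫ y, F ε t y * g y) (Ici 0))
    (hlim : ∀ g : Plane → ℝ, Integrable g → TendstoUniformlyOn
      (fun ε t => ∫ y, F ε t y * g y) (fun _ => ∫ y, ρ0 y * g y) (𝓝[E] 0) (Icc 0 T))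
    {K : Set Plane} (hK : IsCompact K) (p : ℝ≥0∞) : TendstoCWeak E T K p F ρ0 := by
  have : IsFiniteMeasure ((volume : Measure Plane).restrict K) :=
    ⟨by simpa using hK.measure_lt_top⟩
  refine ⟨fun ε hε t ht => ?_, fun q hpq φ hφ => ?_⟩
  · have h1 := hF ε hε t ht.1
    refine MemLp.of_bound h1.1.restrict M (ae_restrict_of_ae ?_)
    filter_upwards [h1.2] with y hy
    rw [Real.norm_of_nonneg hy.1]
    exact hy.2
  · have hq : 1 ≤ q := hpq.symm.le
    -- As `K` has finite measure, an element of `L^q(K)` extended by zero is in `L¹`, so the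
    -- exponent plays no further role.
    have hφi : Integrable (K.indicator φ) := by
      rw [integrable_indicator_iff hK.measurableSet]
      exact hφ.integrable hq
    have e : ∀ f : Plane → ℝ, ∫ y in K, f y * φ y = ∫ y, f y * K.indicator φ y := by
      intro f
      rw [← integral_indicator hK.measurableSet]
      refine integral_congr_ae (.of_forall fun y => ?_)
      exact indicator_mul_right K f φ
    simp only [e]
    exact ⟨fun ε hε => (hcont ε hε _ hφi).mono Icc_subset_Ici_self, hlim _ hφi⟩

theorem tendsto_meanVelocitySq {E : Set ℝ} {ℓ α : ℝ → ℝ} (hℓ_pos : ∀ ε ∈ E, 0 < ℓ ε)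
    (hα_nonneg : ∀ ε ∈ E, 0 ≤ α ε) (hℓ_lim : Tendsto ℓ (𝓝[E] 0) (𝓝 0))
    (hlam : Tendsto (fun ε => α ε / ℓ ε) (𝓝[E] 0) atTop) {ρin : ℝ → Space3 → ℝ}
    {m : ℝ → Space3 → Vec3} {ρ : ℝ → ℝ → Space3 → ℝ} {u : ℝ → ℝ → Space3 → Vec3} {C : ℝ}
    (hC : ∀ ε ∈ E, (2 * ℓ ε)⁻¹ * ∫ x in slab (ℓ ε), ‖m ε x‖ ^ 2 / ρin ε x ≤ C)
    (hsol : ∀ ε ∈ E, IsFiniteEnergyWeakSolution ε (ℓ ε) (α ε) (ρin ε) (m ε) (ρ ε) (u ε))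
    {T : ℝ} (hT : 0 < T) :
    Tendsto (fun ε => meanVelocitySq (ℓ ε) T (u ε)) (𝓝[E] 0) (𝓝 0) := by
  have hlim : Tendsto (fun ε => 2 * C * (α ε / ℓ ε)⁻¹ + 8 * C * ℓ ε ^ 2) (𝓝[E] 0) (𝓝 0) := by
    have h1 := (hlam.inv_tendsto_atTop.const_mul (2 * C)).add
      ((hℓ_lim.pow 2).const_mul (8 * C))
    simpa using h1
  refine tendsto_of_tendsto_of_tendsto_of_le_of_le' tendsto_const_nhds hlim ?_ ?_
  · filter_upwards [self_mem_nhdsWithin] with ε hε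
    exact meanVelocitySq_nonneg (hℓ_pos ε hε) _ _
  -- The coefficient may vanish for some parameters, but is positive once `α/ℓ > 0`.
  · filter_upwards [self_mem_nhdsWithin, hlam.eventually_gt_atTop 0] with ε hε hpos
    have hα : 0 < α ε := by
      refine lt_of_le_of_ne (hα_nonneg ε hε) fun h0 => ?_
      rw [← h0, zero_div] at hpos
      exact lt_irrefl _ hpos
    exact (hsol ε hε).meanVelocitySq_le (hℓ_pos ε hε) hα (hC ε hε) hT

theorem theorem3p2
    (E : Set ℝ) (hE : E ⊆ Ioc 0 1) (hE0 : (0 : ℝ) ∈ closure E)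
    (ℓ α : ℝ → ℝ) (hℓ_pos : ∀ ε ∈ E, 0 < ℓ ε) (hα_nonneg : ∀ ε ∈ E, 0 ≤ α ε)
    (hℓ_mono : MonotoneOn ℓ E) (hℓ_lim : Tendsto ℓ (𝓝[E] 0) (𝓝 0))
    (hlam : Tendsto (fun ε => α ε / ℓ ε) (𝓝[E] 0) atTop)
    (ρ0 : Plane → ℝ) (rin : ℝ → Space3 → ℝ) (m : ℝ → Space3 → Vec3)
    (hdata : InitialDataAssumptions E ℓ ρ0 rin m)
    (hρ0 : ¬ ∃ c : ℝ, ∀ y, ρ0 y = c)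
    (ρ : ℝ → ℝ → Space3 → ℝ) (u : ℝ → ℝ → Space3 → Vec3)
    (hsol : ∀ ε ∈ E, IsFiniteEnergyWeakSolution ε (ℓ ε) (α ε)
      (initialDensity ρ0 rin ε) (m ε) (ρ ε) (u ε)) :
    -- weak-* convergence of the averaged densities
    (∀ T : ℝ, 0 < T → TendstoWeakStar E T (fun ε t => vAvg (ℓ ε) (ρ ε t)) ρ0) ∧
    -- convergence in `C⁰([0,T]; L^p_w(K))` of the averaged densities, redefined on a null set
    -- of times
    (∃ F : ℝ → ℝ → Plane → ℝ,
      (∀ ε ∈ E, ∀ᵐ t ∂(volume.restrict (Ioi (0 : ℝ))), F ε t =ᵐ[volume] vAvg (ℓ ε) (ρ ε t)) ∧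
      ∀ T : ℝ, 0 < T → ∀ K : Set Plane, IsCompact K → ∀ p : ENNReal, 1 ≤ p → p ≠ ⊤ →
        TendstoCWeak E T K p F ρ0) ∧
    -- strong convergence to zero of the averaged velocities in `L²([0,T]; L²(ℝ²))`
    (∀ T : ℝ, 0 < T →
      (∀ ε ∈ E, MemLp (fun q : ℝ × Plane => vAvg (ℓ ε) (u ε q.1) q.2) 2 (planeCylMeasure T)) ∧
      Tendsto (fun ε => eLpNorm (fun q : ℝ × Plane => vAvg (ℓ ε) (u ε q.1) q.2) 2
        (planeCylMeasure T)) (𝓝[E] 0) (𝓝 0)) := by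
  obtain ⟨ρs, hρs, hρ0_bd, hρin_bd⟩ := hdata.density_bounds
  obtain ⟨C, hC⟩ := hdata.energy_unif
  obtain ⟨Cr, hCr⟩ := hdata.perturbation_Linfty
  have hM : 0 ≤ 2 * ρs := by positivity
  -- A single `β`, the identity on the common range of all initial densities, makes the flux
  -- constant `Cβ` independent of `ε`.
  obtain ⟨β, hβ, hβid⟩ := exists_isC1b_eq_id (2 * ρs)
  obtain ⟨Cβ, hCβ⟩ := hβ.2
  obtain ⟨S, hS, hd⟩ := exists_seq_isTest_dense_integral
  have hvel : ∀ ε ∈ E, ∀ T : ℝ, 0 < T →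
      MemLp (fun q : ℝ × Space3 => u ε q.1 q.2) 2 (cylMeasure (ℓ ε) T) := by
    intro ε hε
    obtain ⟨-, -, Du, γp, γm, hv, -⟩ := hsol ε hε
    exact hv.memLp
  have hmean : ∀ T : ℝ, 0 < T →
      Tendsto (fun ε => meanVelocitySq (ℓ ε) T (u ε)) (𝓝[E] 0) (𝓝 0) := fun T hT =>
    tendsto_meanVelocitySq hℓ_pos hα_nonneg hℓ_lim hlam hC hsol hT
  have hρ0b : IsBetween (2 * ρs) ρ0 := by
    refine ⟨hdata.profile_C2.continuous.aestronglyMeasurable, .of_forall fun y => ?_⟩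
    exact ⟨(hρ0_bd y).1, by linarith [(hρ0_bd y).2]⟩
  have hrep : ∀ ε ∈ E, ∃ F : ℝ → Plane → ℝ,
      (∀ᵐ t ∂(volume.restrict (Ioi (0 : ℝ))), F t =ᵐ[volume] vAvg (ℓ ε) (ρ ε t)) ∧
      (∀ t, 0 ≤ t → IsBetween (2 * ρs) (F t)) ∧
      (∀ g : Plane → ℝ, Integrable g → ContinuousOn (fun t => ∫ y, F t y * g y) (Ici 0)) ∧
      ∀ T, 0 < T → ∀ t ∈ Icc 0 T, ∀ n, |(∫ y, F t y * S n y)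
          - ∫ y, vAvg (ℓ ε) (initialDensity ρ0 rin ε) y * S n y|
        ≤ Cβ * (√(meanVelocitySq (ℓ ε) T (u ε)) * √(T * ∫ y, gradSize (S n) y ^ 2)) := by
    intro ε hε
    have hρ := (hsol ε hε).1
    exact (hsol ε hε).2.1.exists_representative (hℓ_pos ε hε) hM (fun T hT => (hρ T hT).1.1)
      (fun T hT => (hρ T hT).2) (hvel ε hε) (hdata.density_memLp ε hε).1 (hρin_bd ε hε) hβ hβid
      (fun s => (hCβ s).1) hS hd
  -- One representative per `ε`, on the whole half-line: it serves every `T`, `K` and `p`.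
  choose! F hF_ae hF_bd hF_cont hF_init using hrep
  have hinit : ∀ ε ∈ E, ∀ n, |(∫ y, vAvg (ℓ ε) (initialDensity ρ0 rin ε) y * S n y)
      - ∫ y, ρ0 y * S n y| ≤ ε * Cr * ∫ y, |S n y| := by
    intro ε hε n
    have hb := (isBetween_vAvg (hℓ_pos ε hε) (hdata.density_memLp ε hε).1 (hρin_bd ε hε)).1
    have hSi : Integrable (S n) := (hS n).integrable
    have hsub := (hb.integrable_mul hSi).sub (hρ0b.integrable_mul hSi)
    rw [← integral_sub (hb.integrable_mul hSi) (hρ0b.integrable_mul hSi), ← integral_const_mul]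
    refine abs_integral_le_integral_abs.trans
      (integral_mono_ae hsub.abs (hSi.abs.const_mul _) ?_)
    filter_upwards [ae_abs_vAvg_initialDensity_sub_le (hℓ_pos ε hε) (hE hε).1
      (hdata.density_memLp ε hε) (hCr ε hε)] with y hy
    rw [← sub_mul, abs_mul]
    exact mul_le_mul_of_nonneg_right hy (abs_nonneg _)
  have hunif : ∀ T : ℝ, 0 < T → ∀ g : Plane → ℝ, Integrable g → TendstoUniformlyOn
      (fun ε t => ∫ y, F ε t y * g y) (fun _ => ∫ y, ρ0 y * g y) (𝓝[E] 0) (Icc 0 T) := by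
    intro T hT g hg
    refine tendstoUniformlyOn_pairing hM hF_bd hρ0b hS hd
      (e := fun n ε => Cβ * (√(meanVelocitySq (ℓ ε) T (u ε))
        * √(T * ∫ y, gradSize (S n) y ^ 2)))
      (e' := fun n ε => ε * Cr * ∫ y, |S n y|) (fun n => ?_) (fun n => ?_)
      (fun ε hε => hF_init ε hε T hT) hinit hg
    · have h1 := (Real.continuous_sqrt.tendsto _).comp (hmean T hT)
      simpa using (h1.mul_const (√(T * ∫ y, gradSize (S n) y ^ 2))).const_mul Cβ
    · have h1 : Tendsto (fun ε : ℝ => ε) (𝓝[E] 0) (𝓝 0) := tendsto_id.mono_left nhdsWithin_le_nhds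
      simpa using (h1.mul_const Cr).mul_const (∫ y, |S n y|)
  have hmem : ∀ T : ℝ, 0 < T → ∀ ε ∈ E, MemLp (fun q : ℝ × Plane => vAvg (ℓ ε) (ρ ε q.1) q.2) ⊤
      (planeCylMeasure T) := fun T hT ε hε =>
    memLp_top_vAvg (hℓ_pos ε hε) ((hsol ε hε).1 T hT).1
  refine ⟨fun T hT => ⟨hmem T hT, fun φ hφ => ?_⟩, ⟨F, hF_ae, fun T hT K hK p _ _ => ?_⟩,
    fun T hT => ⟨fun ε hε => (memLp_vAvg_and_integral_sq_le (hℓ_pos ε hε) (hvel ε hε T hT)).1, ?_⟩⟩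
  · exact tendsto_integral_planeCyl (f := fun ε t => vAvg (ℓ ε) (ρ ε t)) hF_bd hρ0b (hmem T hT)
      hF_ae (fun g hg t ht => (hunif T hT g hg).tendsto_at (Ioo_subset_Icc_self ht)) hφ
  · exact tendstoCWeak_of_pairing hF_bd hF_cont (hunif T hT) hK p
  · have h1 : Tendsto (fun ε => ENNReal.ofReal (√(meanVelocitySq (ℓ ε) T (u ε)))) (𝓝[E] 0)
        (𝓝 0) := by
      have h2 := (Real.continuous_sqrt.tendsto _).comp (hmean T hT)
      simpa using ENNReal.tendsto_ofReal h2
    refine tendsto_of_tendsto_of_tendsto_of_le_of_le' tendsto_const_nhds h1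
      (.of_forall fun _ => bot_le) ?_
    filter_upwards [self_mem_nhdsWithin] with ε hε
    obtain ⟨h3, h4⟩ := memLp_vAvg_and_integral_sq_le (hℓ_pos ε hε) (hvel ε hε T hT)
    rw [eLpNorm_two_eq_ofReal_sqrt h3]
    exact ENNReal.ofReal_le_ofReal (Real.sqrt_le_sqrt h4)
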